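/- Let $N\ge 1$, $p>1$, and let $d\gamma_N=\phi_N\,dx$ with $\phi_N(x)=(2\pi)^{-N/2}e^{-|x|^2/2}$ be the Gaussian measure on $\mathbb R^N$. For an open set $\Omega\subset\mathbb R^N$, let $W^{1,p}(\Omega,\phi_N)$ be the space of $w\in W^{1,1}_{loc}(\Omega)$ with $w,|Dw|\in L^p(\Omega,\gamma_N)$, normed by $\|w\|_{L^p(\Omega,\gamma_N)}+\|Dw\|_{L^p(\Omega,\gamma_N)}$, and let $W^{1,p}_0(\Omega,\phi_N)$ be the closure of $C_0^\infty(\Omega)$ in it. Put $$\lambda_1(\Omega)=\inf_{w\in W^{1,p}_0(\Omega,\phi_N)\setminus\{0\}}\frac{\int_\Omega|Dw|^p\,d\gamma_N}{\int_\Omega|w|^p\,d\gamma_N}$$ and, for $\alpha\in\mathbb R$, $$Q_p(\alpha,\Omega)=\sup_{w\in W^{1,p}_0(\Omega,\phi_N)}\left\{-\int_\Omega|Dw|^p\,d\gamma_N+\alpha\int_\Omega|w|^p\,d\gamma_N+p\int_\Omega w\,d\gamma_N\right\}\in[0,+\infty].$$ For $t\in\mathbb R$ let $H_t=\{x\in\mathbb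 R^N: x_1<t\}$ and $Q_p^\sharp(\alpha,t)=Q_p(\alpha,H_t)$. Then: 1. For every $\alpha<0$, $Q_p^\sharp(\alpha,t)$ is finite for every $t\in\mathbb R$, and $$\lim_{t\to+\infty}Q_p^\sharp(\alpha,t)=(p-1)\left(-\frac1\alpha\right)^{\frac1{p-1}}.$$ 2. For $\alpha=0$, $Q_p^\sharp(0,t)$ is finite for every $t\in\mathbb R$, and $\lim_{t\to+\infty}Q_p^\sharp(0,t)=+\infty$. 3. For every $\alpha>0$ there exists $\bar t\in\mathbb R$ with $\lambda_1(H_{\bar t})=\alpha$, and for every such $\bar t$ (which is therefore unique): for every $t\in\mathbb R$, $Q_p^\sharp(\alpha,t)$ is finite if and only if $t<\bar t$, and $$\lim_{t\to\bar t^-}Q_p^\sharp(\alpha,t)=+\infty.$$ -/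

import Mathlib

open MeasureTheory Filter Topology TopologicalSpace
open scoped ENNReal Distributions

noncomputable section

namespace GaussTorsion

/-- The space `ℝ^N` with its Euclidean norm. -/
abbrev Space (N : ℕ) : Type := EuclideanSpace ℝ (Fin N)

/-- The Gaussian density `φ_N(x) = (2π)^(-N/2) exp(-|x|²/2)`. -/
def gaussDensity (N : ℕ) (x : Space N) : ℝ :=
  1 / (2 * Real.pi) ^ ((N : ℝ) / 2) * Real.exp (-‖x‖ ^ 2 / 2)

/-- The Gaussian measure `dγ_N = φ_N dx`. -/
def gaussMeasure (N : ℕ) : Measure (Space N) :=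
  (volume : Measure (Space N)).withDensity fun x => ENNReal.ofReal (gaussDensity N x)

variable {N : ℕ}

/-- `G` is a weak (distributional) gradient of `w` on the open set `Ω`, both being locally
integrable on `Ω` with respect to Lebesgue measure. In particular `w ∈ W^{1,1}_loc(Ω)`. -/
structure HasWeakGradient (Ω : Opens (Space N)) (w : Space N → ℝ) (G : Space N → Space N) :
    Prop where
  locInt : LocallyIntegrableOn w Ω volume
  locInt_grad : LocallyIntegrableOn G Ω volume
  integral_eq : ∀ (φ : 𝓓(Ω, ℝ)) (i : Fin N),
    ∫ x in (Ω : Set (Space N)), w x * gradient (φ : Space N → ℝ) x i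
      = -∫ x in (Ω : Set (Space N)), G x i * φ x

/-- `w ∈ W^{1,p}(Ω, φ_N)`, with weak gradient `G`. -/
structure MemW1p (p : ℝ) (Ω : Opens (Space N)) (w : Space N → ℝ) (G : Space N → Space N) :
    Prop where
  weakGrad : HasWeakGradient Ω w G
  memLp : MemLp w (ENNReal.ofReal p) ((gaussMeasure N).restrict Ω)
  memLp_grad : MemLp G (ENNReal.ofReal p) ((gaussMeasure N).restrict Ω)

/-- `w ∈ W_0^{1,p}(Ω, φ_N)`, with weak gradient `G`: `w` lies in the closure of `C_0^∞(Ω)` in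
`W^{1,p}(Ω, φ_N)`. -/
structure MemW01p (p : ℝ) (Ω : Opens (Space N)) (w : Space N → ℝ) (G : Space N → Space N) :
    Prop where
  memW1p : MemW1p p Ω w G
  approx : ∀ ε : ℝ≥0∞, 0 < ε → ∃ φ : 𝓓(Ω, ℝ),
    eLpNorm (fun x => w x - φ x) (ENNReal.ofReal p) ((gaussMeasure N).restrict Ω)
      + eLpNorm (fun x => G x - gradient (φ : Space N → ℝ) x) (ENNReal.ofReal p)
          ((gaussMeasure N).restrict Ω) < ε

/-- The first eigenvalue `λ_1(Ω)` of the Gaussian `p`-Laplacian with Dirichlet boundary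
conditions: the infimum of the Rayleigh quotients `∫|Dw|^p dγ_N / ∫|w|^p dγ_N` over
`w ∈ W_0^{1,p}(Ω, φ_N)`, `w ≠ 0`. -/
def firstEigenvalue (p : ℝ) (Ω : Opens (Space N)) : EReal :=
  ⨅ (w : Space N → ℝ) (G : Space N → Space N) (_ : MemW01p p Ω w G)
    (_ : ¬ w =ᵐ[(gaussMeasure N).restrict Ω] 0),
    (((∫ x in (Ω : Set (Space N)), ‖G x‖ ^ p ∂gaussMeasure N)
      / ∫ x in (Ω : Set (Space N)), |w x| ^ p ∂gaussMeasure N : ℝ) : EReal)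

/-- The functional `F_α(w) = -∫|Dw|^p dγ_N + α ∫|w|^p dγ_N + p ∫ w dγ_N`, `Dw = G`. -/
def functional (p α : ℝ) (Ω : Opens (Space N)) (w : Space N → ℝ) (G : Space N → Space N) : ℝ :=
  -(∫ x in (Ω : Set (Space N)), ‖G x‖ ^ p ∂gaussMeasure N)
    + α * (∫ x in (Ω : Set (Space N)), |w x| ^ p ∂gaussMeasure N)
    + p * ∫ x in (Ω : Set (Space N)), w x ∂gaussMeasure N

/-- The generalized torsional rigidity `Q_p(α, Ω) ∈ [0, +∞]`: the supremum of `F_α` over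
`W_0^{1,p}(Ω, φ_N)`. -/
def torsion (p α : ℝ) (Ω : Opens (Space N)) : EReal :=
  ⨆ (w : Space N → ℝ) (G : Space N → Space N) (_ : MemW01p p Ω w G),
    ((functional p α Ω w G : ℝ) : EReal)

/-- The half-space `H_t = {x : x_1 < t}` of `ℝ^N`, `N ≥ 1`. The first coordinate has index `0`. -/
def halfSpace (N : ℕ) [NeZero N] (t : ℝ) : Opens (Space N) :=
  ⟨{x | x 0 < t}, isOpen_lt (by fun_prop) continuous_const⟩

/-- `Q_p^♯(α, t) = Q_p(α, H_t)`. -/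
def torsionSharp (N : ℕ) [NeZero N] (p α t : ℝ) : EReal :=
  torsion p α (halfSpace N t)

/-- An extended real number is finite. -/
def IsFinite (q : EReal) : Prop := ∃ r : ℝ, q = (r : EReal)

end GaussTorsion

end

/-! Everything is governed by the constants `c` for which `c ∫|ψ|^p ≤ ∫|Dψ|^p` holds on test
functions of `H_t` (`HalfPoincare`); for `c ≥ 0` this says `c ≤ λ_1(H_t)`.

If such a constant `c ≥ 0` exceeds `α`, then `F_α(w) ≤ ∫ (p w - (c - α)|w|^p) dγ`, and a pointwise
Young inequality bounds this (`torsion_le`). With `c = 0` this is the value claimed in the limit for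
`α < 0`; for `α = 0` a positive constant is needed, and `exists_halfPoincare_pos` supplies one.
Conversely, cutoffs of a constant `c ≥ 0` give `F_α` a value close to `α c^p + p c` once `t` is
large. Optimizing over `c` attains the bound when `α < 0` and gives `+∞` when `α = 0`.

For `α > 0`, the critical `t̄` is the supremum of the `t` for which `α` is admissible. This set is
nonempty and bounded above. Compactness of supports makes `α` admissible at `t̄`, and a Gaussian
translation (`HalfPoincare.translate`) shows that no larger constant is.

Two facts settle finiteness, both resting on a compactness inequality (`exists_compactness_bound`)
that bounds near-minimizers of the Rayleigh quotient, normalized by `∫ψ = 1`, in `L^p`. At `t̄`,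
multiples of near-minimizers make the linear term win, so `F_α` is unbounded, already on half-spaces
slightly smaller than `H_t̄`. For `t < t̄`, the constant is strictly larger than `α`
(`HalfPoincare.exists_const_gt`): otherwise, adding a small plateau to a near-minimizer in `H_t`
would violate the inequality in `H_t̄`. No minimizer, Euler-Lagrange equation or regularity theory
is used. -/

namespace GaussTorsion

/-! ### The Gaussian density and measure. -/

section Gaussian

variable {N : ℕ}

theorem gaussDensity_pos (x : Space N) : 0 < gaussDensity N x := by
  unfold gaussDensity; positivity

theorem continuous_gaussDensity : Continuous (gaussDensity N) := by
  unfold gaussDensity; fun_prop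

theorem integral_gaussMeasure (f : Space N → ℝ) :
    ∫ x, f x ∂gaussMeasure N = ∫ x, gaussDensity N x * f x := by
  rw [gaussMeasure, integral_withDensity_eq_integral_toReal_smul
    (continuous_gaussDensity.measurable.ennreal_ofReal) (by simp)]
  simp [ENNReal.toReal_ofReal (gaussDensity_pos _).le]

theorem integral_gaussDensity : ∫ x : Space N, gaussDensity N x = 1 := by
  unfold gaussDensity
  rw [integral_const_mul]
  have h := GaussianFourier.integral_rexp_neg_mul_sq_norm (V := Space N) (b := 1 / 2) (by norm_num)
  have h2 : (fun x : Space N => Real.exp (-‖x‖ ^ 2 / 2))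
      = fun x => Real.exp (-(1 / 2) * ‖x‖ ^ 2) := by
    ext x; congr 1; ring
  rw [h2, h]
  simp only [finrank_euclideanSpace, Fintype.card_fin]
  rw [show Real.pi / (1 / 2) = 2 * Real.pi by ring]
  have : (0 : ℝ) < (2 * Real.pi) ^ ((N : ℝ) / 2) := by positivity
  field_simp

/-- A nonintegrable function has Bochner integral `0`, which the computed value `1` excludes. -/
theorem integrable_gaussDensity : Integrable (gaussDensity N) := by
  by_contra h
  have := integral_gaussDensity (N := N)
  rw [integral_undef h] at this
  norm_num at this

instance : IsProbabilityMeasure (gaussMeasure N) := by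
  refine ⟨?_⟩
  rw [gaussMeasure, withDensity_apply _ MeasurableSet.univ, Measure.restrict_univ,
    ← ofReal_integral_eq_lintegral_ofReal integrable_gaussDensity
      (Eventually.of_forall fun x => (gaussDensity_pos x).le), integral_gaussDensity]
  simp

/-- The `i`-th standard unit vector. -/
noncomputable abbrev unitVec (i : Fin N) : Space N := EuclideanSpace.single i 1

/-- The `i`-th coordinate as a continuous linear functional. -/
noncomputable abbrev coord (i : Fin N) : Space N →L[ℝ] ℝ := EuclideanSpace.proj i

theorem hasFDerivAt_coord (i : Fin N) (x : Space N) :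
    HasFDerivAt (fun y : Space N => y i) (coord i) x :=
  (coord i).hasFDerivAt

theorem norm_coord_le (i : Fin N) : ‖coord i‖ ≤ 1 :=
  ContinuousLinearMap.opNorm_le_bound _ zero_le_one fun x => by
    simpa using PiLp.norm_apply_le x i

theorem contDiff_coord {n : WithTop ℕ∞} (i : Fin N) : ContDiff ℝ n (fun y : Space N => y i) :=
  (coord i).contDiff

theorem hasFDerivAt_gaussDensity (x : Space N) :
    HasFDerivAt (gaussDensity N) (-(gaussDensity N x) • innerSL ℝ x) x := by
  have h : HasFDerivAt (fun y : Space N => ‖y‖ ^ 2) (2 • innerSL ℝ x) x := by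
    simpa using (hasFDerivAt_id x).norm_sq
  have h2 := ((h.neg.mul_const (1 / 2 : ℝ)).exp).const_mul
    (1 / (2 * Real.pi) ^ ((N : ℝ) / 2))
  have e : (fun y : Space N => 1 / (2 * Real.pi) ^ ((N : ℝ) / 2) *
      Real.exp (-‖y‖ ^ 2 * (1 / 2))) = gaussDensity N := by
    ext y; unfold gaussDensity; congr 2; ring
  have h3 : HasFDerivAt (gaussDensity N) _ x := e ▸ h2
  refine h3.congr_fderiv ?_
  ext y
  have e2 : -‖x‖ ^ 2 / 2 = -‖x‖ ^ 2 * (1 / 2) := by ring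
  simp only [gaussDensity, e2, Pi.neg_apply, smul_apply,
    neg_apply, smul_eq_mul, nsmul_eq_mul]
  push_cast
  ring

end Gaussian

/-! ### Test functions and a Hardy-type inequality from one-dimensional vector fields. -/

section TestFunctions

variable {N : ℕ}

/-- Smooth functions with compact support. -/
structure IsTest (ψ : Space N → ℝ) : Prop where
  contDiff : ContDiff ℝ ((⊤ : ℕ∞) : WithTop ℕ∞) ψ
  compact : HasCompactSupport ψ

theorem IsTest.continuous {ψ : Space N → ℝ} (h : IsTest ψ) : Continuous ψ := h.contDiff.continuous

theorem IsTest.differentiable {ψ : Space N → ℝ} (h : IsTest ψ) : Differentiable ℝ ψ :=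
  h.contDiff.differentiable (by simp)

theorem IsTest.continuous_fderiv {ψ : Space N → ℝ} (h : IsTest ψ) : Continuous (fderiv ℝ ψ) :=
  h.contDiff.continuous_fderiv (by simp)

theorem IsTest.integrable_comp {ψ : Space N → ℝ} (h : IsTest ψ) {F : ℝ → ℝ} (hF : Continuous F)
    (hF0 : F 0 = 0) : Integrable (fun x => F (ψ x)) (gaussMeasure N) :=
  (hF.comp h.continuous).integrable_of_hasCompactSupport (h.compact.comp_left hF0)

theorem IsTest.integrable {ψ : Space N → ℝ} (h : IsTest ψ) : Integrable ψ (gaussMeasure N) :=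
  h.continuous.integrable_of_hasCompactSupport h.compact

theorem continuous_abs_rpow {p : ℝ} (hp : 0 < p) : Continuous fun s : ℝ => |s| ^ p :=
  continuous_abs.rpow_const fun _ => Or.inr hp.le

theorem IsTest.integrable_abs_rpow {ψ : Space N → ℝ} (h : IsTest ψ) {p : ℝ} (hp : 0 < p) :
    Integrable (fun x => |ψ x| ^ p) (gaussMeasure N) :=
  h.integrable_comp (continuous_abs_rpow hp) (by simp [hp.ne'])

theorem IsTest.integrable_rpow {ψ : Space N → ℝ} (h : IsTest ψ) {p : ℝ} (hp : 0 < p) :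
    Integrable (fun x => ψ x ^ p) (gaussMeasure N) :=
  h.integrable_comp (continuous_id.rpow_const fun _ => Or.inr hp.le) (by simp [hp.ne'])

theorem IsTest.continuous_norm_fderiv_rpow {ψ : Space N → ℝ} (h : IsTest ψ) {p : ℝ} (hp : 0 < p) :
    Continuous (fun x => ‖fderiv ℝ ψ x‖ ^ p) :=
  h.continuous_fderiv.norm.rpow_const fun _ => Or.inr hp.le

theorem IsTest.compact_norm_fderiv_rpow {ψ : Space N → ℝ} (h : IsTest ψ) {p : ℝ} (hp : 0 < p) :
    HasCompactSupport (fun x => ‖fderiv ℝ ψ x‖ ^ p) :=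
  (h.compact.fderiv ℝ).comp_left (g := fun L => ‖L‖ ^ p) (by simp [hp.ne'])

theorem IsTest.integrable_fderiv_rpow {ψ : Space N → ℝ} (h : IsTest ψ) {p : ℝ} (hp : 0 < p) :
    Integrable (fun x => ‖fderiv ℝ ψ x‖ ^ p) (gaussMeasure N) :=
  (h.continuous_norm_fderiv_rpow hp).integrable_of_hasCompactSupport (h.compact_norm_fderiv_rpow hp)

theorem IsTest.const_mul {ψ : Space N → ℝ} (h : IsTest ψ) (c : ℝ) : IsTest fun x => c * ψ x :=
  ⟨contDiff_const.mul h.contDiff, h.compact.mul_left⟩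

theorem IsTest.fderiv_const_mul {ψ : Space N → ℝ} (h : IsTest ψ) (c : ℝ) (x : Space N) :
    fderiv ℝ (fun x => c * ψ x) x = c • fderiv ℝ ψ x :=
  _root_.fderiv_const_mul (h.differentiable x) c

/-- The energy `∫ |Dψ|^p dγ`. -/
noncomputable def energy (p : ℝ) (ψ : Space N → ℝ) : ℝ := ∫ x, ‖fderiv ℝ ψ x‖ ^ p ∂gaussMeasure N

/-- The mass `∫ |ψ|^p dγ`. -/
noncomputable def mass (p : ℝ) (ψ : Space N → ℝ) : ℝ := ∫ x, |ψ x| ^ p ∂gaussMeasure N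

theorem energy_nonneg (p : ℝ) (ψ : Space N → ℝ) : 0 ≤ energy p ψ :=
  integral_nonneg fun _ => by positivity

theorem mass_nonneg (p : ℝ) (ψ : Space N → ℝ) : 0 ≤ mass p ψ :=
  integral_nonneg fun _ => by positivity

theorem IsTest.energy_const_mul {ψ : Space N → ℝ} (h : IsTest ψ) {p c : ℝ} (hc : 0 ≤ c) :
    energy p (fun x => c * ψ x) = c ^ p * energy p ψ := by
  unfold energy
  rw [← integral_const_mul]
  congr 1; ext x
  rw [h.fderiv_const_mul, norm_smul, Real.norm_of_nonneg hc, Real.mul_rpow hc (norm_nonneg _)]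

theorem mass_const_mul (ψ : Space N → ℝ) {p c : ℝ} (hc : 0 ≤ c) :
    mass p (fun x => c * ψ x) = c ^ p * mass p ψ := by
  unfold mass
  rw [← integral_const_mul]
  congr 1; ext x
  rw [abs_mul, abs_of_nonneg hc, Real.mul_rpow hc (abs_nonneg _)]

/-- Young's inequality in the form used for Hardy-type estimates. -/
theorem young_hardy {p a b v : ℝ} (hp : 1 < p) (ha : 0 ≤ a) (hb : 0 ≤ b) (hv : 0 ≤ v) :
    p * (b ^ (p - 1) * a * v) ≤ a ^ p + (p - 1) * (b ^ p * v ^ (p / (p - 1))) := by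
  have hq : p.HolderConjugate (p / (p - 1)) := Real.HolderConjugate.conjExponent hp
  have h := Real.young_inequality_of_nonneg ha (b := b ^ (p - 1) * v) (by positivity) hq
  have hp1 : 0 < p - 1 := by linarith
  rw [Real.mul_rpow (by positivity) hv, ← Real.rpow_mul hb,
    show (p - 1) * (p / (p - 1)) = p by field_simp] at h
  have h2 := mul_le_mul_of_nonneg_left h (by linarith : (0 : ℝ) ≤ p)
  calc _ = p * (a * (b ^ (p - 1) * v)) := by ring
    _ ≤ _ := h2
    _ = _ := by field_simp

/-- Integrate `ψ^p` against the Gaussian divergence `v' - x_i v` of the field `v(x_i) e_i`, move the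
derivative onto `ψ^p`, and apply Young's inequality. Every explicit Poincaré or weighted bound below
comes from a choice of `v`. Nonnegativity of `ψ` makes `ψ^p` differentiable with derivative `p
ψ^(p-1) Dψ`. -/
theorem hardy {p : ℝ} (hp : 1 < p) (i : Fin N) {v v' : ℝ → ℝ}
    (hv : ∀ s, HasDerivAt v (v' s) s) (hv' : Continuous v') {ψ : Space N → ℝ} (hψ : IsTest ψ)
    (h0 : ∀ x, 0 ≤ ψ x) :
    ∫ x, |ψ x| ^ p * (v' (x i) - x i * v (x i) - (p - 1) * |v (x i)| ^ (p / (p - 1)))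
      ∂gaussMeasure N ≤ energy p ψ := by
  have hp0 : 0 < p := by linarith
  have hp1 : 0 < p - 1 := by linarith
  have hvc : Continuous v := continuous_iff_continuousAt.2 fun s => (hv s).continuousAt
  have hci : Continuous fun x : Space N => x i := by fun_prop
  set e := unitVec i with he
  have hen : ‖e‖ = 1 := by simp [he]
  set f : Space N → ℝ := fun x => ψ x ^ p with hf
  set g : Space N → ℝ := fun x => v (x i) * gaussDensity N x with hg
  have hfd : ∀ x, HasFDerivAt f ((p * ψ x ^ (p - 1)) • fderiv ℝ ψ x) x := fun x =>
    (hψ.differentiable x).hasFDerivAt.rpow_const (Or.inr hp.le)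
  have hgd : ∀ x, HasFDerivAt g (v (x i) • (-(gaussDensity N x) • innerSL ℝ x) +
      gaussDensity N x • (v' (x i) • coord i)) x :=
    fun x => ((hv (x i)).comp_hasFDerivAt x (hasFDerivAt_coord i x)).mul
      (hasFDerivAt_gaussDensity x)
  have hfe : ∀ x, fderiv ℝ f x e = p * ψ x ^ (p - 1) * fderiv ℝ ψ x e := fun x => by
    rw [(hfd x).fderiv]; simp
  have hge : ∀ x, fderiv ℝ g x e = gaussDensity N x * (v' (x i) - x i * v (x i)) := fun x => by
    rw [(hgd x).fderiv]
    simp [he, EuclideanSpace.inner_single_right]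
    ring
  have hfc : Continuous f := hψ.continuous.rpow_const fun _ => Or.inr hp0.le
  have hfs : HasCompactSupport f := hψ.compact.comp_left (g := fun s => s ^ p) (by simp [hp0.ne'])
  have hgc : Continuous g := (hvc.comp hci).mul continuous_gaussDensity
  have hfec : Continuous fun x => fderiv ℝ f x e := by
    simp only [hfe]
    exact (continuous_const.mul (hψ.continuous.rpow_const fun _ => Or.inr hp1.le)).mul
      (hψ.continuous_fderiv.clm_apply continuous_const)
  have hgec : Continuous fun x => fderiv ℝ g x e := by
    simp only [hge]
    exact continuous_gaussDensity.mul ((hv'.comp hci).sub (hci.mul (hvc.comp hci)))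
  have hfes : HasCompactSupport fun x => fderiv ℝ f x e :=
    (hfs.fderiv ℝ).comp_left (g := fun L : Space N →L[ℝ] ℝ => L e) (by simp)
  have ibp := integral_mul_fderiv_eq_neg_fderiv_mul_of_integrable (μ := volume) (f := f) (g := g)
    (v := e) ((hfec.mul hgc).integrable_of_hasCompactSupport hfes.mul_right)
    ((hfc.mul hgec).integrable_of_hasCompactSupport hfs.mul_right)
    ((hfc.mul hgc).integrable_of_hasCompactSupport hfs.mul_right)
    (fun x _ => (hfd x).differentiableAt) (fun x _ => (hgd x).differentiableAt)
  have hwc : Continuous fun x : Space N => |v (x i)| ^ (p / (p - 1)) :=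
    (hvc.comp hci).abs.rpow_const fun _ => Or.inr (by positivity)
  rw [← integral_neg] at ibp
  have i1 : Integrable (fun x => ψ x ^ p * (v' (x i) - x i * v (x i))) (gaussMeasure N) :=
    (hfc.mul ((hv'.comp hci).sub (hci.mul (hvc.comp hci)))).integrable_of_hasCompactSupport
      hfs.mul_right
  have i2 : Integrable (fun x => ψ x ^ p * ((p - 1) * |v (x i)| ^ (p / (p - 1))))
      (gaussMeasure N) :=
    (hfc.mul (continuous_const.mul hwc)).integrable_of_hasCompactSupport hfs.mul_right
  have e1 : ∫ x, ψ x ^ p * (v' (x i) - x i * v (x i)) ∂gaussMeasure N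
      = ∫ x, -(p * (ψ x ^ (p - 1) * fderiv ℝ ψ x e * v (x i))) ∂gaussMeasure N := by
    rw [integral_gaussMeasure, integral_gaussMeasure]
    calc _ = ∫ x, f x * fderiv ℝ g x e := by
          congr 1; ext x; rw [hge]; ring
      _ = _ := ibp
      _ = _ := by congr 1; ext x; rw [hfe]; simp only [hg]; ring
  have i3 : Integrable (fun x => -(p * (ψ x ^ (p - 1) * fderiv ℝ ψ x e * v (x i))))
      (gaussMeasure N) := by
    refine Continuous.integrable_of_hasCompactSupport ?_ ?_
    · exact (continuous_const.mul (((hψ.continuous.rpow_const fun _ => Or.inr hp1.le).mul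
        (hψ.continuous_fderiv.clm_apply continuous_const)).mul (hvc.comp hci))).neg
    · have : (fun x => -(p * (ψ x ^ (p - 1) * fderiv ℝ ψ x e * v (x i))))
          = fun x => fderiv ℝ f x e * (-v (x i)) := by
        ext x; rw [hfe]; ring
      rw [this]; exact hfes.mul_right
  have i4 := hψ.integrable_fderiv_rpow hp0
  have key : ∫ x, -(p * (ψ x ^ (p - 1) * fderiv ℝ ψ x e * v (x i))) ∂gaussMeasure N
      ≤ ∫ x, (‖fderiv ℝ ψ x‖ ^ p + ψ x ^ p * ((p - 1) * |v (x i)| ^ (p / (p - 1))))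
        ∂gaussMeasure N := by
    refine integral_mono i3 (i4.add i2) fun x => ?_
    have hy := young_hardy hp (norm_nonneg (fderiv ℝ ψ x)) (h0 x) (abs_nonneg (v (x i)))
    have hle : |fderiv ℝ ψ x e| ≤ ‖fderiv ℝ ψ x‖ := by
      simpa [hen] using (fderiv ℝ ψ x).le_opNorm e
    have h3 : -(fderiv ℝ ψ x e * v (x i)) ≤ ‖fderiv ℝ ψ x‖ * |v (x i)| := by
      calc _ ≤ |fderiv ℝ ψ x e * v (x i)| := neg_le_abs _
        _ = |fderiv ℝ ψ x e| * |v (x i)| := abs_mul _ _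
        _ ≤ _ := by gcongr
    have h4 : 0 ≤ p * ψ x ^ (p - 1) := mul_nonneg hp0.le (Real.rpow_nonneg (h0 x) _)
    have := mul_le_mul_of_nonneg_left h3 h4
    simp only
    nlinarith
  rw [integral_add i4 i2] at key
  calc _ = ∫ x, (ψ x ^ p * (v' (x i) - x i * v (x i))
        - ψ x ^ p * ((p - 1) * |v (x i)| ^ (p / (p - 1)))) ∂gaussMeasure N := by
        congr 1; ext x; rw [abs_of_nonneg (h0 x)]; ring
    _ ≤ _ := by
        rw [integral_sub i1 i2, e1]
        unfold energy
        linarith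

end TestFunctions

/-! ### From inequalities on test functions to `W_0^{1,p}`, eigenvalue and torsion. -/

section Bridge

variable {N : ℕ} {Ω : Opens (Space N)}

/-- Smooth functions with compact support in `Ω`. -/
structure IsTestIn (Ω : Opens (Space N)) (ψ : Space N → ℝ) : Prop extends IsTest ψ where
  subset : tsupport ψ ⊆ Ω

/-- Bundle a smooth function with compact support in `Ω`. -/
def IsTestIn.toTestFunction {ψ : Space N → ℝ} (h : IsTestIn Ω ψ) : 𝓓(Ω, ℝ) :=
  ⟨ψ, h.contDiff, h.compact, h.subset⟩

theorem isTestIn_coe (φ : 𝓓(Ω, ℝ)) : IsTestIn Ω φ :=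
  ⟨⟨φ.contDiff, φ.hasCompactSupport⟩, φ.tsupport_subset⟩

theorem norm_gradient (f : Space N → ℝ) (x : Space N) : ‖gradient f x‖ = ‖fderiv ℝ f x‖ := by
  unfold gradient; simp

theorem gradient_apply (f : Space N → ℝ) (x : Space N) (i : Fin N) :
    gradient f x i = fderiv ℝ f x (unitVec i) := by
  rw [← inner_gradient_left, EuclideanSpace.inner_single_right]; simp

theorem IsTest.continuous_gradient {ψ : Space N → ℝ} (h : IsTest ψ) : Continuous (gradient ψ) := by
  unfold gradient
  exact (LinearIsometryEquiv.continuous _).comp h.continuous_fderiv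

theorem IsTest.compact_gradient {ψ : Space N → ℝ} (h : IsTest ψ) :
    HasCompactSupport (gradient ψ) := by
  unfold gradient
  exact (h.compact.fderiv ℝ).comp_left (g := (InnerProductSpace.toDual ℝ (Space N)).symm) (by simp)

theorem IsTestIn.eq_zero {ψ : Space N → ℝ} (h : IsTestIn Ω ψ) {x : Space N} (hx : x ∉ Ω) :
    ψ x = 0 := image_eq_zero_of_notMem_tsupport fun h' => hx (h.subset h')

theorem IsTestIn.fderiv_eq_zero {ψ : Space N → ℝ} (h : IsTestIn Ω ψ) {x : Space N} (hx : x ∉ Ω) :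
    fderiv ℝ ψ x = 0 :=
  image_eq_zero_of_notMem_tsupport fun h' => hx (h.subset (tsupport_fderiv_subset ℝ h'))

theorem IsTestIn.setIntegral_norm_gradient {ψ : Space N → ℝ} (h : IsTestIn Ω ψ) {p : ℝ}
    (hp : 0 < p) :
    ∫ x in (Ω : Set (Space N)), ‖gradient ψ x‖ ^ p ∂gaussMeasure N = energy p ψ := by
  rw [setIntegral_eq_integral_of_forall_compl_eq_zero]
  · simp only [norm_gradient]; rfl
  · intro x hx
    rw [norm_gradient, h.fderiv_eq_zero hx]; simp [hp.ne']

theorem IsTestIn.setIntegral_abs {ψ : Space N → ℝ} (h : IsTestIn Ω ψ) {p : ℝ}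
    (hp : 0 < p) : ∫ x in (Ω : Set (Space N)), |ψ x| ^ p ∂gaussMeasure N = mass p ψ := by
  rw [setIntegral_eq_integral_of_forall_compl_eq_zero]
  · rfl
  · intro x hx
    rw [h.eq_zero hx]; simp [hp.ne']

theorem IsTestIn.memW01p {ψ : Space N → ℝ} (h : IsTestIn Ω ψ) (p : ℝ) :
    MemW01p p Ω ψ (gradient ψ) := by
  refine ⟨⟨⟨?_, ?_, ?_⟩, ?_, ?_⟩, ?_⟩
  · exact h.continuous.locallyIntegrable.locallyIntegrableOn _
  · exact h.continuous_gradient.locallyIntegrable.locallyIntegrableOn _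
  · intro φ i
    have hφ := isTestIn_coe φ
    rw [setIntegral_eq_integral_of_forall_compl_eq_zero
        (fun x hx => by rw [h.eq_zero hx, zero_mul]),
      setIntegral_eq_integral_of_forall_compl_eq_zero
        (fun x hx => by rw [hφ.eq_zero hx, mul_zero])]
    simp only [gradient_apply]
    have c1 : Continuous fun x => fderiv ℝ ψ x (unitVec i) :=
      h.continuous_fderiv.clm_apply continuous_const
    have c2 : Continuous fun x => fderiv ℝ (φ : Space N → ℝ) x (unitVec i) :=
      hφ.continuous_fderiv.clm_apply continuous_const
    exact integral_mul_fderiv_eq_neg_fderiv_mul_of_integrable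
      ((c1.mul hφ.continuous).integrable_of_hasCompactSupport hφ.compact.mul_left)
      ((h.continuous.mul c2).integrable_of_hasCompactSupport h.compact.mul_right)
      ((h.continuous.mul hφ.continuous).integrable_of_hasCompactSupport h.compact.mul_right)
      (fun x _ => h.differentiable x) (fun x _ => hφ.differentiable x)
  · exact (h.continuous.memLp_of_hasCompactSupport h.compact).restrict _
  · exact (h.continuous_gradient.memLp_of_hasCompactSupport h.compact_gradient).restrict _
  · intro ε hε
    refine ⟨h.toTestFunction, ?_⟩
    have : ⇑h.toTestFunction = ψ := rfl
    simpa [this] using hε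

theorem eLpNorm_eq_ofReal {E : Type*} [NormedAddCommGroup E] {p : ℝ} (hp : 0 < p)
    {μ : Measure (Space N)} {f : Space N → E} (hf : MemLp f (ENNReal.ofReal p) μ) :
    eLpNorm f (ENNReal.ofReal p) μ = ENNReal.ofReal ((∫ x, ‖f x‖ ^ p ∂μ) ^ p⁻¹) := by
  rw [hf.eLpNorm_eq_integral_rpow_norm (by simpa using hp) (by simp), ENNReal.toReal_ofReal hp.le]

/-- A Poincaré inequality on test functions extends to `W_0^{1,p}`. -/
theorem MemW01p.poincare {p c : ℝ} (hp : 1 < p) (hc : 0 ≤ c)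
    (h : ∀ ψ, IsTestIn Ω ψ → c * mass p ψ ≤ energy p ψ) {w : Space N → ℝ} {G : Space N → Space N}
    (hw : MemW01p p Ω w G) :
    c * ∫ x in (Ω : Set (Space N)), |w x| ^ p ∂gaussMeasure N
      ≤ ∫ x in (Ω : Set (Space N)), ‖G x‖ ^ p ∂gaussMeasure N := by
  have hp0 : 0 < p := by linarith
  set μ := (gaussMeasure N).restrict Ω with hμ
  set P := ENNReal.ofReal p with hP
  have hP1 : 1 ≤ P := by rw [hP]; simpa using hp.le
  -- Taking `p`-th roots turns the inequality into one between norms, which passes to limits by the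
  -- triangle inequality.
  set k := c ^ p⁻¹ with hk
  have hk0 : 0 ≤ k := by positivity
  have hkp : k ^ p = c := Real.rpow_inv_rpow hc hp0.ne'
  have test : ∀ φ : 𝓓(Ω, ℝ), ENNReal.ofReal k * eLpNorm φ P μ
      ≤ eLpNorm (gradient (φ : Space N → ℝ)) P μ := by
    intro φ
    have hφ := isTestIn_coe φ
    have hm := (hφ.memW01p p).memW1p
    rw [eLpNorm_eq_ofReal hp0 hm.memLp, eLpNorm_eq_ofReal hp0 hm.memLp_grad,
      ← ENNReal.ofReal_mul hk0]
    simp only [Real.norm_eq_abs]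
    rw [hφ.setIntegral_abs hp0, hφ.setIntegral_norm_gradient hp0, hk,
      ← Real.mul_rpow hc (mass_nonneg _ _)]
    exact ENNReal.ofReal_le_ofReal (Real.rpow_le_rpow (mul_nonneg hc (mass_nonneg _ _)) (h φ hφ)
      (by positivity))
  have key : ENNReal.ofReal k * eLpNorm w P μ ≤ eLpNorm G P μ := by
    refine ENNReal.le_of_forall_pos_le_add fun ε hε _ => ?_
    have hk1 : 0 < k + 1 := by linarith
    -- The approximation error enters once with factor `k` and once with factor `1`, hence the
    -- division by `k + 1`.
    obtain ⟨φ, hφ⟩ := hw.approx (ENNReal.ofReal (ε / (k + 1))) (by simp; positivity)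
    set δ := ENNReal.ofReal (ε / (k + 1)) with hδ
    have hm := ((isTestIn_coe φ).memW01p p).memW1p
    have hA : eLpNorm (fun x => w x - φ x) P μ ≤ δ := (le_self_add.trans_lt hφ).le
    have hB : eLpNorm (fun x => G x - gradient (φ : Space N → ℝ) x) P μ ≤ δ :=
      (le_add_self.trans_lt hφ).le
    have h1 : eLpNorm w P μ ≤ δ + eLpNorm φ P μ := by
      have := eLpNorm_add_le (hw.memW1p.memLp.sub hm.memLp).aestronglyMeasurable
        hm.memLp.aestronglyMeasurable hP1
      rw [sub_add_cancel] at this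
      exact this.trans (add_le_add hA le_rfl)
    have h2 : eLpNorm (gradient (φ : Space N → ℝ)) P μ ≤ eLpNorm G P μ + δ := by
      have := eLpNorm_sub_le hw.memW1p.memLp_grad.aestronglyMeasurable
        (hw.memW1p.memLp_grad.sub hm.memLp_grad).aestronglyMeasurable hP1
      rw [sub_sub_cancel] at this
      exact this.trans (add_le_add le_rfl hB)
    calc _ ≤ ENNReal.ofReal k * (δ + eLpNorm φ P μ) := by gcongr
      _ = ENNReal.ofReal k * δ + ENNReal.ofReal k * eLpNorm φ P μ := mul_add _ _ _
      _ ≤ ENNReal.ofReal k * δ + (eLpNorm G P μ + δ) := by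
          gcongr; exact (test φ).trans h2
      _ = eLpNorm G P μ + (ENNReal.ofReal k + 1) * δ := by ring
      _ = _ := by
          congr 1
          rw [hδ, ← ENNReal.ofReal_one, ← ENNReal.ofReal_add hk0 zero_le_one,
            ← ENNReal.ofReal_mul hk1.le, mul_div_cancel₀ _ hk1.ne']
          simp
  rw [eLpNorm_eq_ofReal hp0 hw.memW1p.memLp, eLpNorm_eq_ofReal hp0 hw.memW1p.memLp_grad,
    ← ENNReal.ofReal_mul hk0, ENNReal.ofReal_le_ofReal_iff (by positivity), hk,
    ← Real.mul_rpow hc (by positivity)] at key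
  simp only [Real.norm_eq_abs] at key
  exact (Real.rpow_le_rpow_iff (by positivity) (by positivity) (by positivity)).1 key

theorem MemW01p.integrable_abs_rpow {p : ℝ} (hp : 1 < p) {w : Space N → ℝ} {G : Space N → Space N}
    (hw : MemW01p p Ω w G) :
    Integrable (fun x => |w x| ^ p) ((gaussMeasure N).restrict Ω) := by
  have := hw.memW1p.memLp.integrable_norm_rpow (by simp; linarith) (by simp)
  rwa [ENNReal.toReal_ofReal (by linarith)] at this

theorem MemW01p.integrable {p : ℝ} (hp : 1 < p) {w : Space N → ℝ} {G : Space N → Space N}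
    (hw : MemW01p p Ω w G) : Integrable w ((gaussMeasure N).restrict Ω) :=
  hw.memW1p.memLp.integrable (by simpa using hp.le)

theorem le_firstEigenvalue {p c : ℝ} (hp : 1 < p) (hc : 0 ≤ c)
    (h : ∀ ψ, IsTestIn Ω ψ → c * mass p ψ ≤ energy p ψ) :
    (c : EReal) ≤ firstEigenvalue p Ω := by
  refine le_iInf fun w => le_iInf fun G => le_iInf fun hw => le_iInf fun hne => ?_
  rw [EReal.coe_le_coe_iff, le_div_iff₀]
  · exact hw.poincare hp hc h
  · refine lt_of_le_of_ne (integral_nonneg fun _ => by positivity) fun h0 => hne ?_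
    rw [eq_comm, integral_eq_zero_iff_of_nonneg (fun _ => by positivity)
      (hw.integrable_abs_rpow hp)] at h0
    filter_upwards [h0] with x hx
    simpa using (Real.rpow_eq_zero (abs_nonneg _) (by linarith)).1 hx

theorem mul_mass_le_energy_of_le_firstEigenvalue {p c : ℝ} (hp : 1 < p)
    (h : (c : EReal) ≤ firstEigenvalue p Ω) {ψ : Space N → ℝ} (hψ : IsTestIn Ω ψ) :
    c * mass p ψ ≤ energy p ψ := by
  have hp0 : 0 < p := by linarith
  rcases (mass_nonneg p ψ).eq_or_lt with h0 | h0
  · rw [← h0, mul_zero]; exact energy_nonneg _ _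
  rw [← le_div_iff₀ h0, ← EReal.coe_le_coe_iff]
  refine h.trans ?_
  have hne : ¬ ψ =ᵐ[(gaussMeasure N).restrict Ω] 0 := fun h1 => by
    have : ∫ x in (Ω : Set (Space N)), |ψ x| ^ p ∂gaussMeasure N = 0 := by
      rw [← integral_zero (Space N) ℝ (μ := (gaussMeasure N).restrict Ω)]
      refine integral_congr_ae ?_
      filter_upwards [h1] with x hx
      simp [hx, hp0.ne']
    rw [hψ.setIntegral_abs hp0] at this
    exact h0.ne' this
  rw [firstEigenvalue]
  refine iInf_le_of_le ψ (iInf_le_of_le (gradient ψ) (iInf_le_of_le (hψ.memW01p p)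
    (iInf_le_of_le hne ?_)))
  rw [hψ.setIntegral_abs hp0, hψ.setIntegral_norm_gradient hp0]

/-- The functional `F_α` on test functions. -/
noncomputable def testFunctional (p α : ℝ) (ψ : Space N → ℝ) : ℝ :=
  -energy p ψ + α * mass p ψ + p * ∫ x, ψ x ∂gaussMeasure N

theorem testFunctional_le_torsion {p : ℝ} (hp : 1 < p) (α : ℝ) {ψ : Space N → ℝ}
    (hψ : IsTestIn Ω ψ) : ((testFunctional p α ψ : ℝ) : EReal) ≤ torsion p α Ω := by
  have hp0 : 0 < p := by linarith
  refine le_iSup_of_le ψ (le_iSup_of_le (gradient ψ) (le_iSup_of_le (hψ.memW01p p) ?_))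
  rw [functional, hψ.setIntegral_abs hp0, hψ.setIntegral_norm_gradient hp0,
    setIntegral_eq_integral_of_forall_compl_eq_zero (fun x hx => hψ.eq_zero hx)]
  rfl

/-- The right side is the maximum of the left side over `w`, attained at `w = (1/β)^(1/(p-1))`. It
comes from Young's inequality for `β^(1/p)|w|` times `β^(-1/p)`. -/
theorem young_linear {p β : ℝ} (hp : 1 < p) (hβ : 0 < β) (w : ℝ) :
    p * w - β * |w| ^ p ≤ (p - 1) * (1 / β) ^ (1 / (p - 1)) := by
  have hq : p.HolderConjugate (p / (p - 1)) := Real.HolderConjugate.conjExponent hp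
  have hp1 : 0 < p - 1 := by linarith
  have hp0 : 0 < p := by linarith
  have h := Real.young_inequality_of_nonneg (a := β ^ p⁻¹ * |w|) (b := (1 / β) ^ p⁻¹)
    (by positivity) (by positivity) hq
  rw [Real.mul_rpow (by positivity) (abs_nonneg _), Real.rpow_inv_rpow hβ.le hp0.ne',
    ← Real.rpow_mul (by positivity), show p⁻¹ * (p / (p - 1)) = 1 / (p - 1) by field_simp,
    mul_right_comm, ← Real.mul_rpow hβ.le (by positivity), mul_one_div_cancel hβ.ne',
    Real.one_rpow, one_mul] at h
  have h2 := mul_le_mul_of_nonneg_left h hp0.le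
  have h3 : p * w ≤ p * |w| := by gcongr; exact le_abs_self w
  have e : p * (β * |w| ^ p / p + (1 / β) ^ (1 / (p - 1)) / (p / (p - 1)))
      = β * |w| ^ p + (p - 1) * (1 / β) ^ (1 / (p - 1)) := by
    field_simp
  linarith

/-- The Poincaré inequality absorbs the gradient term, leaving `∫ (p w - (c - α)|w|^p)`; the
integrand is bounded by a constant, and `γ(Ω) ≤ 1`. -/
theorem torsion_le {p α c : ℝ} (hp : 1 < p) (hc : 0 ≤ c) (hα : α < c)
    (h : ∀ ψ, IsTestIn Ω ψ → c * mass p ψ ≤ energy p ψ) :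
    torsion p α Ω ≤ (((p - 1) * (1 / (c - α)) ^ (1 / (p - 1)) : ℝ) : EReal) := by
  refine iSup_le fun w => iSup_le fun G => iSup_le fun hw => ?_
  rw [EReal.coe_le_coe_iff]
  set K := (p - 1) * (1 / (c - α)) ^ (1 / (p - 1)) with hK
  have hcα : 0 < c - α := by linarith
  have hK0 : 0 ≤ K := mul_nonneg (by linarith) (by positivity)
  have i1 := hw.integrable_abs_rpow hp
  have i2 := hw.integrable hp
  have h1 : ∫ x in (Ω : Set (Space N)), (p * w x - (c - α) * |w x| ^ p) ∂gaussMeasure N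
      ≤ ∫ x in (Ω : Set (Space N)), K ∂gaussMeasure N :=
    integral_mono ((i2.const_mul _).sub (i1.const_mul _)) (integrable_const _)
      fun x => young_linear hp hcα (w x)
  rw [integral_sub (i2.const_mul _) (i1.const_mul _), integral_const_mul, integral_const_mul,
    integral_const, smul_eq_mul] at h1
  have h2 : ((gaussMeasure N).restrict Ω).real Set.univ * K ≤ 1 * K := by
    gcongr
    rw [measureReal_restrict_apply_univ]
    exact measureReal_le_one
  have h3 := hw.poincare hp hc h
  unfold functional
  linarith

theorem isTestIn_zero : IsTestIn Ω (fun _ => (0 : ℝ)) :=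
  ⟨⟨contDiff_const, HasCompactSupport.zero⟩, by simp [tsupport, Function.support]⟩

theorem torsion_isFinite {p α c : ℝ} (hp : 1 < p) (hc : 0 ≤ c) (hα : α < c)
    (h : ∀ ψ, IsTestIn Ω ψ → c * mass p ψ ≤ energy p ψ) : IsFinite (torsion p α Ω) := by
  have h1 := torsion_le hp hc hα h
  have h2 := testFunctional_le_torsion hp α (isTestIn_zero (Ω := Ω))
  refine ⟨_, (EReal.coe_toReal ?_ ?_).symm⟩
  · exact (h1.trans_lt (EReal.coe_lt_top _)).ne
  · exact ((EReal.bot_lt_coe _).trans_le h2).ne'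

/-- A Poincaré inequality on nonnegative test functions extends to all test functions. -/
theorem poincare_of_nonneg {p c : ℝ} (hp : 1 < p)
    (h : ∀ ψ, IsTestIn Ω ψ → (∀ x, 0 ≤ ψ x) → c * mass p ψ ≤ energy p ψ) {φ : Space N → ℝ}
    (hφ : IsTestIn Ω φ) : c * mass p φ ≤ energy p φ := by
  have hp0 : 0 < p := by linarith
  -- A smooth regularization of `|φ|` that vanishes wherever `φ` does, stays below `|φ|`, and has
  -- gradient no larger than that of `φ`.
  set u : ℝ → Space N → ℝ := fun δ x => Real.sqrt (φ x ^ 2 + δ ^ 2) - δ with hu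
  have hu0 : ∀ δ, 0 < δ → ∀ x, 0 ≤ u δ x := fun δ hδ x => by
    simp only [hu, sub_nonneg]
    exact Real.le_sqrt_of_sq_le (by nlinarith [sq_nonneg (φ x)])
  have hu1 : ∀ δ, 0 < δ → ∀ x, u δ x ≤ |φ x| := fun δ hδ x => by
    simp only [hu, sub_le_iff_le_add]
    rw [Real.sqrt_le_left (by positivity)]
    nlinarith [sq_abs (φ x), mul_nonneg (abs_nonneg (φ x)) hδ.le]
  have ht : ∀ δ, 0 < δ → IsTestIn Ω (u δ) := fun δ hδ => by
    have hs : tsupport (u δ) ⊆ tsupport φ := closure_mono fun x hx => by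
      contrapose! hx
      simp only [Function.mem_support, not_not] at hx ⊢
      simp [hu, hx, Real.sqrt_sq hδ.le]
    refine ⟨⟨?_, ?_⟩, hs.trans hφ.subset⟩
    · refine ContDiff.sub (ContDiff.sqrt ((hφ.contDiff.pow 2).add contDiff_const) fun x => ?_)
        contDiff_const
      positivity
    · exact hφ.compact.of_isClosed_subset (isClosed_tsupport _) hs
  have hE : ∀ δ, 0 < δ → energy p (u δ) ≤ energy p φ := fun δ hδ => by
    refine integral_mono ((ht δ hδ).integrable_fderiv_rpow hp0) (hφ.integrable_fderiv_rpow hp0)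
      fun x => Real.rpow_le_rpow (norm_nonneg _) ?_ hp0.le
    have hpos : 0 < φ x ^ 2 + δ ^ 2 := by positivity
    have hd : HasFDerivAt (u δ) _ x :=
      ((((hφ.differentiable x).hasFDerivAt.pow 2).add_const (δ ^ 2)).sqrt hpos.ne').sub_const δ
    rw [hd.fderiv, ← smul_assoc, norm_smul]
    refine mul_le_of_le_one_left (norm_nonneg _) ?_
    have hsq : 0 < Real.sqrt (φ x ^ 2 + δ ^ 2) := Real.sqrt_pos.2 hpos
    simp only [Nat.cast_ofNat, Nat.add_one_sub_one, pow_one, smul_eq_mul, nsmul_eq_mul]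
    rw [Real.norm_eq_abs, show 1 / (2 * Real.sqrt (φ x ^ 2 + δ ^ 2)) * (2 * φ x)
      = φ x / Real.sqrt (φ x ^ 2 + δ ^ 2) by field_simp, abs_div, abs_of_pos hsq, div_le_one hsq]
    exact Real.abs_le_sqrt (by nlinarith)
  have hlim : Tendsto (fun δ => mass p (u δ)) (𝓝[>] 0) (𝓝 (mass p φ)) := by
    unfold mass
    refine tendsto_integral_filter_of_dominated_convergence (fun x => |φ x| ^ p) ?_ ?_
      (hφ.integrable_abs_rpow hp0) ?_
    · filter_upwards [self_mem_nhdsWithin] with δ hδ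
      exact ((ht δ hδ).integrable_abs_rpow hp0).aestronglyMeasurable
    · filter_upwards [self_mem_nhdsWithin] with δ hδ
      refine Eventually.of_forall fun x => ?_
      rw [Real.norm_of_nonneg (by positivity), abs_of_nonneg (hu0 δ hδ x)]
      exact Real.rpow_le_rpow (hu0 δ hδ x) (hu1 δ hδ x) hp0.le
    · refine Eventually.of_forall fun x => ?_
      have hcont : Continuous fun δ : ℝ => |u δ x| ^ p :=
        (continuous_abs_rpow hp0).comp (by simp only [hu]; fun_prop)
      have := (hcont.tendsto 0).mono_left (nhdsWithin_le_nhds (s := Set.Ioi 0))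
      simpa [hu, Real.sqrt_sq_eq_abs] using this
  refine le_of_tendsto (hlim.const_mul c) ?_
  filter_upwards [self_mem_nhdsWithin] with δ hδ
  exact (h _ (ht δ hδ) (hu0 δ hδ)).trans (hE δ hδ)

end Bridge

/-! ### Poincaré constants of half-spaces: explicit bounds and dependence on `t`. -/

section HalfSpace

variable {N : ℕ} [NeZero N]

/-- The Poincaré inequality with constant `c` on test functions of the half-space `H_t`. -/
def HalfPoincare (N : ℕ) [NeZero N] (p t c : ℝ) : Prop :=
  ∀ ψ : Space N → ℝ, IsTestIn (halfSpace N t) ψ → c * mass p ψ ≤ energy p ψ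

theorem mem_halfSpace {t : ℝ} {x : Space N} : x ∈ halfSpace N t ↔ x 0 < t := Iff.rfl

theorem IsTestIn.mono {t t' : ℝ} (h : t ≤ t') {ψ : Space N → ℝ}
    (hψ : IsTestIn (halfSpace N t) ψ) : IsTestIn (halfSpace N t') ψ :=
  ⟨hψ.toIsTest, fun _ hx => lt_of_lt_of_le (hψ.subset hx) h⟩

theorem HalfPoincare.anti {p t t' c : ℝ} (h : t ≤ t') (hP : HalfPoincare N p t' c) :
    HalfPoincare N p t c := fun ψ hψ => hP ψ (hψ.mono h)

theorem HalfPoincare.anti_const {p t c c' : ℝ} (h : c ≤ c') (hP : HalfPoincare N p t c') :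
    HalfPoincare N p t c := fun ψ hψ =>
  (mul_le_mul_of_nonneg_right h (mass_nonneg _ _)).trans (hP ψ hψ)

theorem IsTest.exists_halfSpace {ψ : Space N → ℝ} (hψ : IsTest ψ) :
    ∃ t, IsTestIn (halfSpace N t) ψ := by
  have hc : Continuous fun x : Space N => x 0 := by fun_prop
  obtain ⟨b, hb⟩ := (hψ.compact.isCompact.image hc).bddAbove
  refine ⟨b + 1, hψ, fun x hx => ?_⟩
  have : x 0 ≤ b := hb ⟨x, hx, rfl⟩
  exact mem_halfSpace.2 (by linarith)

/-- A compact support keeps a positive distance from the bounding hyperplane. This gives left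
continuity in `t`, both for Poincaré constants and for the torsion. -/
theorem IsTestIn.exists_lt {t : ℝ} {ψ : Space N → ℝ} (hψ : IsTestIn (halfSpace N t) ψ) :
    ∃ t' < t, IsTestIn (halfSpace N t') ψ := by
  have hc : Continuous fun x : Space N => x 0 := by fun_prop
  rcases (tsupport ψ).eq_empty_or_nonempty with he | hne
  · exact ⟨t - 1, by linarith, hψ.toIsTest, by rw [he]; exact Set.empty_subset _⟩
  · obtain ⟨y, hy, hmax⟩ := hψ.compact.isCompact.exists_isMaxOn hne hc.continuousOn
    have hyt : y 0 < t := hψ.subset hy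
    refine ⟨(y 0 + t) / 2, by linarith, hψ.toIsTest, fun x hx => ?_⟩
    have : x 0 ≤ y 0 := hmax hx
    exact mem_halfSpace.2 (by linarith)

/-- Reduces a Poincaré inequality on `H_t` to a Riccati-type differential inequality on `(-∞, t)`.
-/
theorem halfPoincare_of_hardy {p : ℝ} (hp : 1 < p) {t c : ℝ} {v v' : ℝ → ℝ}
    (hv : ∀ s, HasDerivAt v (v' s) s) (hv' : Continuous v')
    (h : ∀ s < t, c ≤ v' s - s * v s - (p - 1) * |v s| ^ (p / (p - 1))) :
    HalfPoincare N p t c := by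
  have hp0 : 0 < p := by linarith
  have hp1 : 0 < p - 1 := by linarith
  have hvc : Continuous v := continuous_iff_continuousAt.2 fun s => (hv s).continuousAt
  intro φ hφ
  refine poincare_of_nonneg hp (fun ψ hψ h0 => ?_) hφ
  refine le_trans ?_ (hardy hp 0 hv hv' hψ.toIsTest h0)
  have hci : Continuous fun x : Space N => x 0 := by fun_prop
  rw [mass, ← integral_const_mul]
  refine integral_mono ((hψ.integrable_abs_rpow hp0).const_mul c) ?_ fun x => ?_
  · refine Continuous.integrable_of_hasCompactSupport ?_ ?_
    · refine ((continuous_abs_rpow hp0).comp hψ.continuous).mul ?_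
      exact ((hv'.comp hci).sub (hci.mul (hvc.comp hci))).sub (continuous_const.mul
        ((hvc.comp hci).abs.rpow_const fun _ => Or.inr (by positivity)))
    · exact (hψ.compact.comp_left (g := fun s => |s| ^ p) (by simp [hp0.ne'])).mul_right
  · by_cases hx : x ∈ halfSpace N t
    · have := mul_le_mul_of_nonneg_left (h (x 0) hx)
        (by positivity : (0 : ℝ) ≤ |ψ x| ^ p)
      simp only
      linarith
    · simp [hψ.eq_zero hx, hp0.ne']

/-- The constant field `v = 1` yields a constant tending to `+∞` as `t → -∞`, so every `α` is
admissible for some `t`. -/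
theorem halfPoincare_neg {p : ℝ} (hp : 1 < p) (t : ℝ) : HalfPoincare N p t (-t - (p - 1)) := by
  refine halfPoincare_of_hardy hp (v := fun _ => 1) (v' := fun _ => 0)
    (fun s => hasDerivAt_const s 1) continuous_const fun s hs => ?_
  simp only [abs_one, Real.one_rpow]
  linarith

/-- For `v = ε(1 + e^(ks))` the linear part `v' - s v` is at least `ε m` on `(-∞, t)`, while the
Young term is `O(ε^q)` with `q > 1`; a small `ε` leaves a positive remainder. -/
theorem exists_halfPoincare_pos {p : ℝ} (hp : 1 < p) (t : ℝ) :
    ∃ c > 0, HalfPoincare N p t c := by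
  have hp1 : 0 < p - 1 := by linarith
  set q := p / (p - 1) with hq
  have hq1 : 1 < q := by rw [hq, one_lt_div hp1]; linarith
  set k := 2 * |t| + 1 with hk
  have hk1 : 1 ≤ k := by rw [hk]; linarith [abs_nonneg t]
  have htk : t ≤ k := by rw [hk]; linarith [abs_nonneg t, le_abs_self t]
  set m := k * Real.exp (-k) with hm
  have hm0 : 0 < m := by positivity
  have hm1 : m ≤ 1 := by
    have := Real.add_one_le_exp k
    rw [hm, Real.exp_neg, ← div_eq_mul_inv, div_le_one (Real.exp_pos _)]
    linarith
  set B := 1 + Real.exp (k * k) with hB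
  have hB0 : 0 < B := by positivity
  -- For `s ≤ -1` the term `-s` suffices; on `[-1, 0]` the term `k e^(ks)` does; for `s ≥ 0` the
  -- choice of `k` gives `k - 2s ≥ 1`.
  have hlow : ∀ s < t, m ≤ k * Real.exp (k * s) - s * (1 + Real.exp (k * s)) := by
    intro s hs
    have hE := Real.exp_pos (k * s)
    have hst : 2 * s ≤ k - 1 := by
      rw [hk]; linarith [le_abs_self t]
    rcases le_total s (-1) with h1 | h1
    · nlinarith [mul_nonneg (by linarith : 0 ≤ k - 1) hE.le,
        mul_nonneg (by linarith : 0 ≤ -s - 1) hE.le]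
    rcases le_total s 0 with h2 | h2
    · have : Real.exp (-k) ≤ Real.exp (k * s) := Real.exp_le_exp.2 (by nlinarith)
      have h3 : m ≤ k * Real.exp (k * s) := by rw [hm]; gcongr
      nlinarith
    · have : 1 ≤ Real.exp (k * s) := Real.one_le_exp (by positivity)
      nlinarith
  have hlim : Tendsto (fun ε : ℝ => (p - 1) * B ^ q * ε ^ (q - 1)) (𝓝[>] 0) (𝓝 0) := by
    have hc : Continuous fun ε : ℝ => (p - 1) * B ^ q * ε ^ (q - 1) :=
      continuous_const.mul (continuous_id.rpow_const fun _ => Or.inr (by linarith))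
    have := (hc.tendsto 0).mono_left (nhdsWithin_le_nhds (s := Set.Ioi 0))
    rwa [Real.zero_rpow (by linarith), mul_zero] at this
  obtain ⟨ε, hε1, hε⟩ := ((hlim.eventually_lt_const hm0).and self_mem_nhdsWithin).exists
  have hε0 : 0 < ε := hε
  refine ⟨ε * (m - (p - 1) * B ^ q * ε ^ (q - 1)), mul_pos hε0 (by linarith), ?_⟩
  refine halfPoincare_of_hardy hp (v := fun s => ε * (1 + Real.exp (k * s)))
    (v' := fun s => ε * (k * Real.exp (k * s))) (fun s => ?_) (by fun_prop) fun s hs => ?_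
  · have := ((((hasDerivAt_id s).const_mul k).exp).const_add 1).const_mul ε
    simpa [mul_comm] using this
  · have h1 : |ε * (1 + Real.exp (k * s))| ^ q ≤ ε * ε ^ (q - 1) * B ^ q := by
      rw [abs_of_pos (by positivity), Real.mul_rpow hε0.le (by positivity)]
      have : ε ^ q = ε * ε ^ (q - 1) := by
        rw [← Real.rpow_one_add' hε0.le (by linarith)]; congr 1; ring
      rw [this]
      gcongr
      rw [hB]
      gcongr
      linarith
    have h2 := mul_le_mul_of_nonneg_left (hlow s hs) hε0.le
    have h3 := mul_le_mul_of_nonneg_left h1 hp1.le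
    linarith

/-- Convexity of `y^p` with weights `1/(1+δ)` and `δ/(1+δ)`. -/
theorem add_mul_rpow_le {p a b δ : ℝ} (hp : 1 < p) (ha : 0 ≤ a) (hb : 0 ≤ b) (hδ : 0 ≤ δ) :
    (a + δ * b) ^ p ≤ (1 + δ) ^ (p - 1) * (a ^ p + δ * b ^ p) := by
  have h1 : 0 < 1 + δ := by linarith
  have h := (convexOn_rpow hp.le).2 (Set.mem_Ici.2 ha) (Set.mem_Ici.2 hb)
    (by positivity : 0 ≤ 1 / (1 + δ)) (by positivity : 0 ≤ δ / (1 + δ)) (by field_simp)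
  simp only [smul_eq_mul] at h
  rw [show 1 / (1 + δ) * a + δ / (1 + δ) * b = (a + δ * b) / (1 + δ) by field_simp,
    Real.div_rpow (by positivity) h1.le, div_le_iff₀ (by positivity)] at h
  refine h.trans_eq ?_
  rw [Real.rpow_sub_one h1.ne']
  field_simp

/-- Shifting a function by `a` and multiplying by the `p`-th root of the density ratio preserves its
`L^p(γ)` norm, and the exponential factor adds at most `δ|ψ|` to the gradient. As `δ → 0` the new
constant tends to `c`, so a constant below `c` survives on a slightly larger half-space. -/
theorem HalfPoincare.translate {p : ℝ} (hp : 1 < p) {t c δ : ℝ} (hδ : 0 ≤ δ)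
    (h : HalfPoincare N p t c) :
    HalfPoincare N p (t + p * δ) (c / (1 + δ) ^ (p - 1) - δ) := by
  have hp0 : 0 < p := by linarith
  intro ψ hψ
  set s := p * δ with hs
  set a : Space N := s • unitVec 0 with ha
  -- `p ℓ(x) = -s x_1 - s²/2` is the logarithm of the density ratio at `x + a` and `x`; the shift `s
  -- = p δ` makes `ℓ` have slope `-δ`.
  set ℓ : Space N → ℝ := fun x => -(δ * x 0 + δ * s / 2) with hℓ
  set u : Space N → ℝ := fun x => ψ (x + a) * Real.exp (ℓ x) with hu
  have ha0 : ∀ x : Space N, (x + a) 0 = x 0 + s := fun x => by simp [ha]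
  have hdens : ∀ x : Space N, gaussDensity N x * Real.exp (ℓ x) ^ p = gaussDensity N (x + a) := by
    intro x
    have : ‖x + a‖ ^ 2 = ‖x‖ ^ 2 + 2 * (s * x 0) + s ^ 2 := by
      rw [norm_add_sq_real, ha, inner_smul_right, EuclideanSpace.inner_single_right, norm_smul]
      simp
    unfold gaussDensity
    rw [this, mul_assoc, ← Real.exp_mul, ← Real.exp_add]
    congr 2
    simp only [hℓ, hs]
    ring
  have hut : IsTestIn (halfSpace N t) u := by
    have hsup : tsupport u ⊆ (fun x => x + a) ⁻¹' tsupport ψ := by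
      refine closure_minimal (fun x hx => subset_tsupport _ fun h0 => hx ?_)
        ((isClosed_tsupport ψ).preimage (by fun_prop))
      simp only [hu]; rw [h0, zero_mul]
    refine ⟨⟨?_, ?_⟩, ?_⟩
    · refine (hψ.contDiff.comp (contDiff_id.add contDiff_const)).mul (ContDiff.exp ?_)
      exact ((contDiff_const.mul (contDiff_coord 0)).add contDiff_const).neg
    · exact (hψ.compact.comp_homeomorph (Homeomorph.addRight a)).mul_right
    · intro x hx
      have : (x + a) 0 < t + s := hψ.subset (hsup hx)
      rw [ha0] at this
      exact mem_halfSpace.2 (by linarith)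
  have hmass : mass p u = mass p ψ := by
    unfold mass
    rw [integral_gaussMeasure, integral_gaussMeasure,
      ← integral_add_right_eq_self (fun x => gaussDensity N x * |ψ x| ^ p) a]
    congr 1; ext x
    rw [← hdens, abs_mul, abs_of_pos (Real.exp_pos _), Real.mul_rpow (abs_nonneg _)
      (Real.exp_pos _).le]
    ring
  have hder : ∀ x, ‖fderiv ℝ u x‖ ≤ Real.exp (ℓ x) * (‖fderiv ℝ ψ (x + a)‖ + δ * |ψ (x + a)|) := by
    intro x
    have h1 : HasFDerivAt (fun y => ψ (y + a)) (fderiv ℝ ψ (x + a)) x :=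
      (hasFDerivAt_comp_add_right a).2 (hψ.differentiable (x + a)).hasFDerivAt
    have h2 : HasFDerivAt ℓ (-(δ • coord 0)) x :=
      (((hasFDerivAt_coord 0 x).const_mul δ).add_const (δ * s / 2)).neg
    have h3 := h1.mul h2.exp
    have h4 : fderiv ℝ u x = _ := h3.fderiv
    rw [h4]
    refine (norm_add_le _ _).trans ?_
    rw [norm_smul, norm_smul, norm_smul, norm_neg, norm_smul, Real.norm_eq_abs, Real.norm_eq_abs,
      Real.norm_of_nonneg hδ, abs_of_pos (Real.exp_pos _)]
    have := norm_coord_le (N := N) 0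
    have h5 : |ψ (x + a)| * (Real.exp (ℓ x) * (δ * ‖(coord 0 : Space N →L[ℝ] ℝ)‖))
        ≤ |ψ (x + a)| * (Real.exp (ℓ x) * (δ * 1)) := by gcongr
    linarith
  have henergy : energy p u ≤ (1 + δ) ^ (p - 1) * (energy p ψ + δ * mass p ψ) := by
    have i1 := hψ.integrable_fderiv_rpow hp0
    have i2 := hψ.integrable_abs_rpow hp0
    have hc : Continuous fun x => (‖fderiv ℝ ψ x‖ + δ * |ψ x|) ^ p :=
      (hψ.continuous_fderiv.norm.add (continuous_const.mul hψ.continuous.abs)).rpow_const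
        fun _ => Or.inr hp0.le
    have hcs : HasCompactSupport fun x => (‖fderiv ℝ ψ x‖ + δ * |ψ x|) ^ p := by
      refine HasCompactSupport.comp_left (g := fun s : ℝ => s ^ p) ?_ (by simp [hp0.ne'])
      exact HasCompactSupport.add ((hψ.compact.fderiv ℝ).norm)
        (hψ.compact.comp_left (g := fun s => δ * |s|) (by simp))
    calc energy p u ≤ ∫ x, (‖fderiv ℝ ψ x‖ + δ * |ψ x|) ^ p ∂gaussMeasure N := by
          unfold energy
          rw [integral_gaussMeasure, integral_gaussMeasure, ← integral_add_right_eq_self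
            (fun x => gaussDensity N x * (‖fderiv ℝ ψ x‖ + δ * |ψ x|) ^ p) a]
          refine integral_mono ?_ ?_ fun x => ?_
          · exact (continuous_gaussDensity.mul (hut.continuous_norm_fderiv_rpow hp0)
              ).integrable_of_hasCompactSupport (hut.compact_norm_fderiv_rpow hp0).mul_left
          · exact ((continuous_gaussDensity.mul hc).integrable_of_hasCompactSupport
              hcs.mul_left).comp_add_right a
          · simp only
            rw [← hdens x, mul_assoc, ← Real.mul_rpow (Real.exp_pos _).le (by positivity)]
            exact mul_le_mul_of_nonneg_left
              (Real.rpow_le_rpow (norm_nonneg _) (hder x) hp0.le) (gaussDensity_pos x).le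
      _ ≤ ∫ x, (1 + δ) ^ (p - 1) * (‖fderiv ℝ ψ x‖ ^ p + δ * |ψ x| ^ p) ∂gaussMeasure N :=
          integral_mono (hc.integrable_of_hasCompactSupport hcs)
            ((i1.add (i2.const_mul δ)).const_mul _)
            fun x => add_mul_rpow_le hp (norm_nonneg _) (abs_nonneg _) hδ
      _ = _ := by
          rw [integral_const_mul, integral_add i1 (i2.const_mul δ), integral_const_mul]; rfl
  have hfin := (h u hut).trans henergy
  rw [hmass] at hfin
  have hpos : 0 < (1 + δ) ^ (p - 1) := by positivity
  rw [sub_mul, div_mul_eq_mul_div, sub_le_iff_le_add, div_le_iff₀ hpos]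
  linarith

theorem halfPoincare_of_forall_lt {p t c : ℝ} (h : ∀ t' < t, HalfPoincare N p t' c) :
    HalfPoincare N p t c := fun ψ hψ => by
  obtain ⟨t', ht', h'⟩ := hψ.exists_lt
  exact h t' ht' ψ h'

theorem HalfPoincare.exists_gt {p t c c' : ℝ} (hp : 1 < p) (h : HalfPoincare N p t c)
    (hc : c' < c) : ∃ t' > t, HalfPoincare N p t' c' := by
  have hlim : Tendsto (fun δ : ℝ => c / (1 + δ) ^ (p - 1) - δ) (𝓝[>] 0) (𝓝 c) := by
    have hc : ContinuousAt (fun δ : ℝ => c / (1 + δ) ^ (p - 1) - δ) 0 := by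
      refine ContinuousAt.sub (continuousAt_const.div ?_ (by simp)) continuousAt_id
      exact ContinuousAt.rpow_const (by fun_prop) (Or.inl (by simp))
    have := hc.tendsto.mono_left (nhdsWithin_le_nhds (s := Set.Ioi 0))
    simpa using this
  obtain ⟨δ, hδ1, hδ⟩ := ((hlim.eventually_const_lt hc).and self_mem_nhdsWithin).exists
  have hδ0 : 0 < δ := hδ
  exact ⟨t + p * δ, by nlinarith, (h.translate hp hδ0.le).anti_const hδ1.le⟩

end HalfSpace

/-! ### A quantitative compactness inequality for the Gaussian Sobolev norm. -/

section Compactness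

variable {N : ℕ}

theorem lintegral_rpow_le_of_isProbabilityMeasure {α : Type*} [MeasurableSpace α] {μ : Measure α}
    [IsProbabilityMeasure μ] {p : ℝ} (hp : 1 < p) {f : α → ℝ≥0∞} (hf : AEMeasurable f μ) :
    (∫⁻ a, f a ∂μ) ^ p ≤ ∫⁻ a, f a ^ p ∂μ := by
  have hp0 : 0 < p := by linarith
  have h := ENNReal.lintegral_mul_le_Lp_mul_Lq μ (Real.HolderConjugate.conjExponent hp) hf
    (g := fun _ => 1) aemeasurable_const
  simp only [Pi.mul_def, mul_one, ENNReal.one_rpow, lintegral_const, measure_univ, one_div] at h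
  calc _ ≤ ((∫⁻ a, f a ^ p ∂μ) ^ p⁻¹) ^ p := by gcongr
    _ = _ := by rw [← ENNReal.rpow_mul, inv_mul_cancel₀ hp0.ne', ENNReal.rpow_one]

theorem setLIntegral_comp_add_le {S T : Set (Space N)} (hS : MeasurableSet S)
    (hT : MeasurableSet T) (y : Space N) (h : ∀ x ∈ S, x + y ∈ T) (f : Space N → ℝ≥0∞) :
    ∫⁻ x in S, f (x + y) ≤ ∫⁻ x in T, f x := by
  rw [← lintegral_indicator hS, ← lintegral_indicator hT,
    ← lintegral_add_right_eq_self (T.indicator f) y]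
  refine lintegral_mono fun x => ?_
  by_cases hx : x ∈ S
  · simp [hx, h x hx]
  · simp [hx]

/-- The fundamental theorem of calculus along the segment from `x` to `x + z`, followed by Jensen's
inequality. -/
theorem IsTest.enorm_sub_rpow_le {ψ : Space N → ℝ} (h : IsTest ψ) {p : ℝ} (hp : 1 < p)
    (x z : Space N) :
    ‖ψ (x + z) - ψ x‖ₑ ^ p
      ≤ ‖z‖ₑ ^ p * ∫⁻ τ in Set.Ioc (0 : ℝ) 1, ‖fderiv ℝ ψ (x + τ • z)‖ₑ ^ p := by
  have hp0 : 0 < p := by linarith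
  have hc : Continuous fun τ : ℝ => fderiv ℝ ψ (x + τ • z) :=
    h.continuous_fderiv.comp (by fun_prop)
  have hd : ∀ τ : ℝ, HasDerivAt (fun τ : ℝ => ψ (x + τ • z)) (fderiv ℝ ψ (x + τ • z) z) τ := by
    intro τ
    have h1 : HasDerivAt (fun τ : ℝ => x + τ • z) z τ := by
      simpa using ((hasDerivAt_id τ).smul_const z).const_add x
    exact (h.differentiable (x + τ • z)).hasFDerivAt.comp_hasDerivAt τ h1
  have hI : ψ (x + z) - ψ x = ∫ τ in Set.Ioc (0 : ℝ) 1, fderiv ℝ ψ (x + τ • z) z := by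
    rw [← intervalIntegral.integral_of_le zero_le_one,
      intervalIntegral.integral_eq_sub_of_hasDerivAt (fun τ _ => hd τ)
        ((hc.clm_apply continuous_const).intervalIntegrable _ _)]
    simp
  have : IsProbabilityMeasure ((volume : Measure ℝ).restrict (Set.Ioc (0 : ℝ) 1)) :=
    ⟨by simp⟩
  have hm : Measurable fun τ : ℝ => ‖fderiv ℝ ψ (x + τ • z)‖ₑ := hc.enorm.measurable
  calc _ ≤ (∫⁻ τ in Set.Ioc (0 : ℝ) 1, ‖z‖ₑ * ‖fderiv ℝ ψ (x + τ • z)‖ₑ) ^ p := by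
        rw [hI]
        gcongr
        refine (enorm_integral_le_lintegral_enorm _).trans (lintegral_mono fun τ => ?_)
        rw [mul_comm]
        exact (fderiv ℝ ψ (x + τ • z)).le_opENorm z
    _ ≤ ∫⁻ τ in Set.Ioc (0 : ℝ) 1, (‖z‖ₑ * ‖fderiv ℝ ψ (x + τ • z)‖ₑ) ^ p :=
        lintegral_rpow_le_of_isProbabilityMeasure hp (hm.const_mul _).aemeasurable
    _ = _ := by
        rw [← lintegral_const_mul _ (hm.pow_const _)]
        simp only [ENNReal.mul_rpow_of_nonneg _ _ hp0.le]

theorem IsTest.setLIntegral_sub_rpow_le {ψ : Space N → ℝ} (h : IsTest ψ) {p : ℝ} (hp : 1 < p)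
    (R : ℝ) {δ : ℝ} (hδ : δ ≤ 1) {z : Space N} (hz : ‖z‖ ≤ δ) :
    ∫⁻ x in Metric.closedBall 0 R, ‖ψ (x + z) - ψ x‖ₑ ^ p
      ≤ ENNReal.ofReal δ ^ p * ∫⁻ x in Metric.closedBall 0 (R + 1), ‖fderiv ℝ ψ x‖ₑ ^ p := by
  have hp0 : 0 < p := by linarith
  have hc : Continuous fun q : Space N × ℝ => ‖fderiv ℝ ψ (q.1 + q.2 • z)‖ₑ ^ p :=
    (ENNReal.continuous_rpow_const).comp (h.continuous_fderiv.comp (by fun_prop)).enorm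
  have : IsProbabilityMeasure ((volume : Measure ℝ).restrict (Set.Ioc (0 : ℝ) 1)) :=
    ⟨by simp⟩
  have hz' : ‖z‖ₑ ≤ ENNReal.ofReal δ := by
    rw [← ofReal_norm]; exact ENNReal.ofReal_le_ofReal hz
  calc _ ≤ ∫⁻ x in Metric.closedBall 0 R,
          ‖z‖ₑ ^ p * ∫⁻ τ in Set.Ioc (0 : ℝ) 1, ‖fderiv ℝ ψ (x + τ • z)‖ₑ ^ p :=
        lintegral_mono fun x => h.enorm_sub_rpow_le hp x z
    _ = ‖z‖ₑ ^ p * ∫⁻ x in Metric.closedBall 0 R,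
          ∫⁻ τ in Set.Ioc (0 : ℝ) 1, ‖fderiv ℝ ψ (x + τ • z)‖ₑ ^ p :=
        lintegral_const_mul _ hc.measurable.lintegral_prod_right'
    _ = ‖z‖ₑ ^ p * ∫⁻ τ in Set.Ioc (0 : ℝ) 1,
          ∫⁻ x in Metric.closedBall 0 R, ‖fderiv ℝ ψ (x + τ • z)‖ₑ ^ p := by
        rw [lintegral_lintegral_swap hc.measurable.aemeasurable]
    _ ≤ ENNReal.ofReal δ ^ p * ∫⁻ τ in Set.Ioc (0 : ℝ) 1,
          ∫⁻ x in Metric.closedBall 0 (R + 1), ‖fderiv ℝ ψ x‖ₑ ^ p := by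
        gcongr ?_ ^ p * ?_
        refine setLIntegral_mono' measurableSet_Ioc fun τ hτ => ?_
        refine setLIntegral_comp_add_le measurableSet_closedBall measurableSet_closedBall (τ • z)
          (fun x hx => ?_) fun x => ‖fderiv ℝ ψ x‖ₑ ^ p
        rw [mem_closedBall_zero_iff] at hx ⊢
        have : ‖τ • z‖ ≤ 1 := by
          rw [norm_smul, Real.norm_of_nonneg hτ.1.le]
          have := norm_nonneg z
          nlinarith [hτ.2, hτ.1]
        linarith [norm_add_le x (τ • z)]
    _ = _ := by rw [lintegral_const, measure_univ, mul_one]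

theorem gaussDensity_anti {x y : Space N} (h : ‖x‖ ≤ ‖y‖) : gaussDensity N y ≤ gaussDensity N x := by
  unfold gaussDensity
  gcongr

/-- On a ball the Gaussian density is bounded below, so Lebesgue integrals there are controlled by
Gaussian ones. -/
theorem setLIntegral_le_gaussMeasure (R : ℝ) : ∃ c : ℝ≥0∞, c ≠ ∞ ∧ ∀ f : Space N → ℝ≥0∞,
    Measurable f → ∫⁻ x in Metric.closedBall 0 R, f x ≤ c * ∫⁻ x, f x ∂gaussMeasure N := by
  set m : ℝ := 1 / (2 * Real.pi) ^ ((N : ℝ) / 2) * Real.exp (-R ^ 2 / 2) with hm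
  have hm0 : 0 < m := by positivity
  refine ⟨(ENNReal.ofReal m)⁻¹, by simp [hm0], fun f hf => ?_⟩
  have hmeas : Measurable fun x : Space N => ENNReal.ofReal (gaussDensity N x) :=
    continuous_gaussDensity.measurable.ennreal_ofReal
  rw [gaussMeasure, lintegral_withDensity_eq_lintegral_mul _ hmeas hf,
    ← lintegral_const_mul _ (hmeas.mul hf)]
  refine le_trans ?_ (setLIntegral_le_lintegral (Metric.closedBall 0 R) _)
  refine setLIntegral_mono' measurableSet_closedBall fun x hx => ?_
  rw [mem_closedBall_zero_iff] at hx
  have : ENNReal.ofReal m ≤ ENNReal.ofReal (gaussDensity N x) := by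
    refine ENNReal.ofReal_le_ofReal ?_
    unfold gaussDensity
    rw [hm]
    gcongr
  calc f x = (ENNReal.ofReal m)⁻¹ * (ENNReal.ofReal m * f x) := by
        rw [← mul_assoc, ENNReal.inv_mul_cancel (by simpa using hm0) (by simp), one_mul]
    _ ≤ _ := by simp only [Pi.mul_apply]; gcongr

theorem setLIntegral_gaussMeasure_le (R : ℝ) {f : Space N → ℝ≥0∞} (hf : Measurable f) :
    ∫⁻ x in Metric.closedBall 0 R, f x ∂gaussMeasure N
      ≤ ENNReal.ofReal (gaussDensity N 0) * ∫⁻ x in Metric.closedBall 0 R, f x := by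
  have hmeas : Measurable fun x : Space N => ENNReal.ofReal (gaussDensity N x) :=
    continuous_gaussDensity.measurable.ennreal_ofReal
  rw [gaussMeasure, restrict_withDensity measurableSet_closedBall,
    lintegral_withDensity_eq_lintegral_mul _ hmeas hf, ← lintegral_const_mul _ hf]
  refine lintegral_mono fun x => ?_
  simp only [Pi.mul_apply]
  gcongr
  exact gaussDensity_anti (by simp)

/-- On balls, the `L^p` norm is controlled by a small multiple of the gradient norm and a large
multiple of the `L^1` norm. -/
theorem local_compactness {p : ℝ} (hp : 1 < p) (R : ℝ) {η : ℝ≥0∞} (hη : 0 < η) :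
    ∃ C : ℝ≥0∞, C ≠ ∞ ∧ ∀ ψ : Space N → ℝ, IsTest ψ →
      ∫⁻ x in Metric.closedBall 0 R, ‖ψ x‖ₑ ^ p ∂gaussMeasure N
        ≤ η * ∫⁻ x, ‖fderiv ℝ ψ x‖ₑ ^ p ∂gaussMeasure N
          + C * (∫⁻ x, ‖ψ x‖ₑ ∂gaussMeasure N) ^ p := by
  have hp0 : 0 < p := by linarith
  obtain ⟨c, hc, hcf⟩ := setLIntegral_le_gaussMeasure (N := N) (R + 1)
  set K := ENNReal.ofReal (gaussDensity N 0) with hK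
  set D := K * 2 ^ (p - 1) with hD
  have hDtop : D ≠ ∞ := ENNReal.mul_ne_top (by simp [hK]) (by simp)
  have hlim : Tendsto (fun δ : ℝ => D * (ENNReal.ofReal δ ^ p * c)) (𝓝[>] 0) (𝓝 0) := by
    have h1 : Continuous fun δ : ℝ => ENNReal.ofReal δ ^ p :=
      ENNReal.continuous_rpow_const.comp ENNReal.continuous_ofReal
    have h2 : Tendsto (fun δ : ℝ => ENNReal.ofReal δ ^ p) (𝓝[>] 0) (𝓝 0) := by
      have := (h1.tendsto 0).mono_left (nhdsWithin_le_nhds (s := Set.Ioi 0))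
      simpa [hp0] using this
    have h3 := ENNReal.Tendsto.mul_const (b := c) h2 (Or.inr hc)
    rw [zero_mul] at h3
    simpa using ENNReal.Tendsto.const_mul (a := D) h3 (Or.inr hDtop)
  obtain ⟨δ, hδη, hδ0, hδ1⟩ := ((hlim.eventually_lt_const hη).and
    (Ioo_mem_nhdsGT (zero_lt_one' ℝ))).exists
  set S := Metric.ball (0 : Space N) δ with hS
  set V := volume S with hV
  have hV0 : V ≠ 0 := (Metric.measure_ball_pos _ _ hδ0).ne'
  have hVt : V ≠ ∞ := measure_ball_lt_top.ne
  set B := Metric.closedBall (0 : Space N) R with hB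
  have hBt : volume B ≠ ∞ := measure_closedBall_lt_top.ne
  -- `ψ(x)` is compared with its average over the ball of radius `δ` about `x`: the difference costs
  -- `δ^p` times the gradient norm, and the average is bounded by the `L^1` norm.
  set ν : Measure (Space N) := V⁻¹ • volume.restrict S with hν
  have : IsProbabilityMeasure ν :=
    ⟨by simp only [hν, Measure.smul_apply, Measure.restrict_apply_univ, smul_eq_mul]
        exact ENNReal.inv_mul_cancel hV0 hVt⟩
  refine ⟨D * (volume B * (V⁻¹ * c) ^ p), ?_, fun ψ hψ => ?_⟩
  · refine ENNReal.mul_ne_top hDtop (ENNReal.mul_ne_top hBt ?_)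
    exact ENNReal.rpow_ne_top_of_nonneg hp0.le (ENNReal.mul_ne_top (by simp [hV0]) hc)
  have hcd : Continuous fun q : Space N × Space N => ‖ψ (q.1 + q.2) - ψ q.1‖ₑ ^ p :=
    ENNReal.continuous_rpow_const.comp
      ((hψ.continuous.comp (by fun_prop)).sub (hψ.continuous.comp (by fun_prop))).enorm
  have hmψ : Measurable fun x => ‖ψ x‖ₑ := hψ.continuous.enorm.measurable
  have hmD : Measurable fun x => ‖fderiv ℝ ψ x‖ₑ ^ p :=
    hψ.continuous_fderiv.enorm.measurable.pow_const _
  have hpt : ∀ x ∈ B, ‖ψ x‖ₑ ^ p ≤ 2 ^ (p - 1) * (∫⁻ z, ‖ψ (x + z) - ψ x‖ₑ ^ p ∂ν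
      + (V⁻¹ * c * ∫⁻ y, ‖ψ y‖ₑ ∂gaussMeasure N) ^ p) := by
    intro x hx
    have hm1 : Measurable fun z => ‖ψ (x + z) - ψ x‖ₑ :=
      ((hψ.continuous.comp (by fun_prop)).sub continuous_const).enorm.measurable
    have h1 : ‖ψ x‖ₑ ≤ ∫⁻ z, ‖ψ (x + z) - ψ x‖ₑ ∂ν + ∫⁻ z, ‖ψ (x + z)‖ₑ ∂ν := by
      rw [← lintegral_add_left hm1]
      calc ‖ψ x‖ₑ = ∫⁻ _, ‖ψ x‖ₑ ∂ν := by simp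
        _ ≤ _ := lintegral_mono fun z => by
          have : ψ x = -(ψ (x + z) - ψ x) + ψ (x + z) := by ring
          calc ‖ψ x‖ₑ = ‖-(ψ (x + z) - ψ x) + ψ (x + z)‖ₑ := by rw [← this]
            _ ≤ _ := (enorm_add_le _ _).trans (by rw [enorm_neg])
    have h2 : ∫⁻ z, ‖ψ (x + z)‖ₑ ∂ν ≤ V⁻¹ * c * ∫⁻ y, ‖ψ y‖ₑ ∂gaussMeasure N := by
      rw [hν, lintegral_smul_measure, smul_eq_mul, mul_assoc]
      gcongr
      refine le_trans ?_ (hcf _ hmψ)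
      simp_rw [add_comm x]
      refine setLIntegral_comp_add_le measurableSet_ball measurableSet_closedBall x
        (fun z hz => ?_) fun y => ‖ψ y‖ₑ
      rw [mem_ball_zero_iff] at hz
      rw [mem_closedBall_zero_iff] at hx ⊢
      linarith [norm_add_le z x]
    calc _ ≤ (∫⁻ z, ‖ψ (x + z) - ψ x‖ₑ ∂ν + V⁻¹ * c * ∫⁻ y, ‖ψ y‖ₑ ∂gaussMeasure N) ^ p := by
          gcongr; exact h1.trans (by gcongr)
      _ ≤ _ := ENNReal.rpow_add_le_mul_rpow_add_rpow _ _ hp.le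
      _ ≤ _ := by
          gcongr
          exact lintegral_rpow_le_of_isProbabilityMeasure hp hm1.aemeasurable
  have hdiff : ∫⁻ x in B, ∫⁻ z, ‖ψ (x + z) - ψ x‖ₑ ^ p ∂ν
      ≤ ENNReal.ofReal δ ^ p * (c * ∫⁻ x, ‖fderiv ℝ ψ x‖ₑ ^ p ∂gaussMeasure N) := by
    rw [lintegral_lintegral_swap hcd.measurable.aemeasurable]
    have hae : ∀ᵐ z ∂ν, ∫⁻ x in B, ‖ψ (x + z) - ψ x‖ₑ ^ p
        ≤ ENNReal.ofReal δ ^ p * (c * ∫⁻ x, ‖fderiv ℝ ψ x‖ₑ ^ p ∂gaussMeasure N) := by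
      refine Measure.ae_smul_measure ?_ _
      filter_upwards [ae_restrict_mem measurableSet_ball] with z hz
      rw [mem_ball_zero_iff] at hz
      refine (hψ.setLIntegral_sub_rpow_le hp R hδ1.le hz.le).trans ?_
      gcongr
      exact hcf _ hmD
    calc _ ≤ ∫⁻ _, _ ∂ν := lintegral_mono_ae hae
      _ = _ := by simp
  calc _ ≤ K * ∫⁻ x in B, ‖ψ x‖ₑ ^ p := setLIntegral_gaussMeasure_le R (hmψ.pow_const _)
    _ ≤ K * ∫⁻ x in B, 2 ^ (p - 1) * (∫⁻ z, ‖ψ (x + z) - ψ x‖ₑ ^ p ∂ν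
          + (V⁻¹ * c * ∫⁻ y, ‖ψ y‖ₑ ∂gaussMeasure N) ^ p) := by
        gcongr 1
        exact setLIntegral_mono' measurableSet_closedBall hpt
    _ = D * ((∫⁻ x in B, ∫⁻ z, ‖ψ (x + z) - ψ x‖ₑ ^ p ∂ν)
          + (V⁻¹ * c * ∫⁻ y, ‖ψ y‖ₑ ∂gaussMeasure N) ^ p * volume B) := by
        rw [lintegral_const_mul' _ _ (by simp), lintegral_add_right _ measurable_const,
          setLIntegral_const, hD, mul_assoc K]
    _ ≤ D * (ENNReal.ofReal δ ^ p * (c * ∫⁻ x, ‖fderiv ℝ ψ x‖ₑ ^ p ∂gaussMeasure N)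
          + (V⁻¹ * c * ∫⁻ y, ‖ψ y‖ₑ ∂gaussMeasure N) ^ p * volume B) := by gcongr
    _ = D * (ENNReal.ofReal δ ^ p * c) * ∫⁻ x, ‖fderiv ℝ ψ x‖ₑ ^ p ∂gaussMeasure N
          + D * (volume B * (V⁻¹ * c) ^ p) * (∫⁻ x, ‖ψ x‖ₑ ∂gaussMeasure N) ^ p := by
        rw [ENNReal.mul_rpow_of_nonneg _ _ hp0.le]; ring
    _ ≤ _ := by gcongr

theorem IsTest.lintegral_enorm_fderiv_rpow {ψ : Space N → ℝ} (h : IsTest ψ) {p : ℝ} (hp : 0 < p) :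
    ∫⁻ x, ‖fderiv ℝ ψ x‖ₑ ^ p ∂gaussMeasure N = ENNReal.ofReal (energy p ψ) := by
  rw [energy, ofReal_integral_eq_lintegral_ofReal (h.integrable_fderiv_rpow hp)
    (Eventually.of_forall fun x => by positivity)]
  refine lintegral_congr fun x => ?_
  rw [← ENNReal.ofReal_rpow_of_nonneg (norm_nonneg _) hp.le, ofReal_norm]

/-- Tightness: a bounded Sobolev norm leaves little `L^p` mass far from the origin. It is the Hardy
inequality in each coordinate with the bounded field `v = -arctan`, for which `-s v` grows like
`|s|`. -/
theorem exists_weighted_bound {p : ℝ} (hp : 1 < p) : ∃ C > 0, ∀ ψ : Space N → ℝ, IsTest ψ →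
    (∀ x, 0 ≤ ψ x) → ∫ x, |ψ x| ^ p * ‖x‖ ∂gaussMeasure N ≤ C * (energy p ψ + mass p ψ) := by
  have hp0 : 0 < p := by linarith
  have hp1 : 0 < p - 1 := by linarith
  set q := p / (p - 1) with hq
  have hq0 : 0 < q := by positivity
  set k := Real.pi / 4 with hk
  have hk0 : 0 < k := by have := Real.pi_pos; positivity
  set C₀ := k + 1 + (p - 1) * (Real.pi / 2) ^ q with hC₀
  have hC₁ : 1 ≤ C₀ := by
    have : 0 ≤ (p - 1) * (Real.pi / 2) ^ q := by have := Real.pi_pos; positivity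
    linarith
  have hpt : ∀ s : ℝ, k * |s| - C₀ ≤ -(1 / (1 + s ^ 2)) - s * (-Real.arctan s)
      - (p - 1) * |-Real.arctan s| ^ q := by
    intro s
    have h1 : 1 / (1 + s ^ 2) ≤ 1 := by
      rw [div_le_one (by positivity)]; nlinarith [sq_nonneg s]
    have habs : |Real.arctan s| ≤ Real.pi / 2 :=
      abs_le.2 ⟨(Real.neg_pi_div_two_lt_arctan s).le, (Real.arctan_lt_pi_div_two s).le⟩
    have h2 : |-Real.arctan s| ^ q ≤ (Real.pi / 2) ^ q := by
      rw [abs_neg]; gcongr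
    -- `arctan ≥ π/4` on `[1, ∞)`; on `[0, 1]` the left side is nonpositive.
    have h3 : k * |s| - k ≤ s * Real.arctan s := by
      have key : ∀ r : ℝ, 0 ≤ r → k * r - k ≤ r * Real.arctan r := by
        intro r hr
        rcases le_total r 1 with h | h
        · have := mul_nonneg hr (Real.arctan_nonneg.2 hr)
          nlinarith
        · have : k ≤ Real.arctan r := by
            rw [hk, ← Real.arctan_one]; exact Real.arctan_strictMono.monotone h
          nlinarith
      rcases le_total 0 s with h | h
      · rw [abs_of_nonneg h]; exact key s h
      · have := key (-s) (by linarith)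
        rw [Real.arctan_neg] at this
        rw [abs_of_nonpos h]; linarith
    have h4 := mul_le_mul_of_nonneg_left h2 hp1.le
    linarith
  refine ⟨(N + 1) * C₀ / k, by positivity, fun ψ hψ h0 => ?_⟩
  have hcψ : Continuous fun x => |ψ x| ^ p := (continuous_abs_rpow hp0).comp hψ.continuous
  have hsψ : HasCompactSupport fun x => |ψ x| ^ p :=
    hψ.compact.comp_left (g := fun s => |s| ^ p) (by simp [hp0.ne'])
  have hi : ∀ g : Space N → ℝ, Continuous g → Integrable (fun x => |ψ x| ^ p * g x)
      (gaussMeasure N) := fun g hg =>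
    (hcψ.mul hg).integrable_of_hasCompactSupport hsψ.mul_right
  have hcoord : ∀ i, k * ∫ x, |ψ x| ^ p * |x i| ∂gaussMeasure N ≤ C₀ * (energy p ψ + mass p ψ) := by
    intro i
    have hci : Continuous fun x : Space N => x i := by fun_prop
    have h1 := hardy hp i (v := fun s => -Real.arctan s) (v' := fun s => -(1 / (1 + s ^ 2)))
      (fun s => (Real.hasDerivAt_arctan s).neg)
      (by
        refine (continuous_const.div (by fun_prop) fun s => ?_).neg
        positivity) hψ h0
    have h2 : ∫ x, |ψ x| ^ p * (k * |x i| - C₀) ∂gaussMeasure N ≤ energy p ψ := by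
      refine le_trans (integral_mono (hi _ (by fun_prop)) (hi _ ?_) fun x => ?_) h1
      · refine ((continuous_const.div (by fun_prop) fun x => ?_).neg.sub (by fun_prop)).sub
          (continuous_const.mul (Continuous.rpow_const (by fun_prop) fun _ => Or.inr hq0.le))
        positivity
      · exact mul_le_mul_of_nonneg_left (hpt (x i)) (by positivity)
    have h3 : ∫ x, |ψ x| ^ p * (k * |x i| - C₀) ∂gaussMeasure N
        = k * ∫ x, |ψ x| ^ p * |x i| ∂gaussMeasure N - C₀ * mass p ψ := by
      rw [mass, ← integral_const_mul, ← integral_const_mul, ← integral_sub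
        ((hi _ (by fun_prop)).const_mul _) ((hψ.integrable_abs_rpow hp0).const_mul _)]
      congr 1; ext x; ring
    nlinarith [energy_nonneg p ψ]
  have hsum : ∫ x, |ψ x| ^ p * ‖x‖ ∂gaussMeasure N
      ≤ ∑ i, ∫ x, |ψ x| ^ p * |x i| ∂gaussMeasure N := by
    rw [← integral_finsetSum _ fun i _ => hi (fun x => |x i|) (by fun_prop)]
    refine integral_mono (hi _ continuous_norm)
      (integrable_finsetSum _ fun i _ => hi (fun x => |x i|) (by fun_prop)) fun x => ?_
    simp only
    rw [← Finset.mul_sum]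
    refine mul_le_mul_of_nonneg_left ?_ (by positivity)
    calc ‖x‖ = ‖∑ i, x i • unitVec i‖ := by
          congr 1
          have := (EuclideanSpace.basisFun (Fin N) ℝ).sum_repr x
          simpa using this.symm
      _ ≤ ∑ i, ‖x i • unitVec i‖ := norm_sum_le _ _
      _ = ∑ i, |x i| := by simp [norm_smul]
  have hE : 0 ≤ energy p ψ + mass p ψ := add_nonneg (energy_nonneg _ _) (mass_nonneg _ _)
  rw [div_mul_eq_mul_div, le_div_iff₀ hk0]
  calc _ ≤ (∑ i, ∫ x, |ψ x| ^ p * |x i| ∂gaussMeasure N) * k := by gcongr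
    _ = ∑ i, k * ∫ x, |ψ x| ^ p * |x i| ∂gaussMeasure N := by
        rw [Finset.sum_mul]; simp only [mul_comm]
    _ ≤ ∑ _i : Fin N, C₀ * (energy p ψ + mass p ψ) := Finset.sum_le_sum fun i _ => hcoord i
    _ = N * (C₀ * (energy p ψ + mass p ψ)) := by simp
    _ ≤ _ := by
        have : 0 ≤ C₀ * (energy p ψ + mass p ψ) := by positivity
        linarith

/-- The `L^p` norm is controlled by a small multiple of the Sobolev norm and a large multiple of
the `L^1` norm. -/
theorem exists_compactness_bound {p : ℝ} (hp : 1 < p) {η : ℝ} (hη : 0 < η) :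
    ∃ C > 0, ∀ ψ : Space N → ℝ, IsTest ψ → (∀ x, 0 ≤ ψ x) →
      mass p ψ ≤ η * (energy p ψ + mass p ψ) + C * (∫ x, ψ x ∂gaussMeasure N) ^ p := by
  have hp0 : 0 < p := by linarith
  obtain ⟨A, hA, hW⟩ := exists_weighted_bound (N := N) hp
  -- With this radius the mass outside the ball costs at most `η/2` of the Sobolev norm; the other
  -- `η/2` is spent inside.
  set R := 2 * A / η with hR
  have hR0 : 0 < R := by positivity
  obtain ⟨C, hC, hloc⟩ := local_compactness (N := N) hp R (η := ENNReal.ofReal (η / 2))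
    (by simpa using hη)
  refine ⟨C.toReal + 1, by positivity, fun ψ hψ h0 => ?_⟩
  have hI0 : 0 ≤ ∫ x, ψ x ∂gaussMeasure N := integral_nonneg h0
  have hE0 := energy_nonneg p ψ
  have hM0 := mass_nonneg p ψ
  have h1 : ∫ x in Metric.closedBall 0 R, |ψ x| ^ p ∂gaussMeasure N
      ≤ η / 2 * energy p ψ + C.toReal * (∫ x, ψ x ∂gaussMeasure N) ^ p := by
    have h := hloc ψ hψ
    have e1 : ∫⁻ x in Metric.closedBall 0 R, ‖ψ x‖ₑ ^ p ∂gaussMeasure N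
        = ENNReal.ofReal (∫ x in Metric.closedBall 0 R, |ψ x| ^ p ∂gaussMeasure N) := by
      rw [ofReal_integral_eq_lintegral_ofReal (hψ.integrable_abs_rpow hp0).restrict
        (Eventually.of_forall fun x => by positivity)]
      refine lintegral_congr fun x => ?_
      rw [← ENNReal.ofReal_rpow_of_nonneg (abs_nonneg _) hp0.le, ← Real.norm_eq_abs,
        ofReal_norm]
    have e2 : ∫⁻ x, ‖ψ x‖ₑ ∂gaussMeasure N = ENNReal.ofReal (∫ x, ψ x ∂gaussMeasure N) := by
      rw [ofReal_integral_eq_lintegral_ofReal hψ.integrable (Eventually.of_forall h0)]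
      exact lintegral_congr fun x => Real.enorm_of_nonneg (h0 x)
    rw [e1, e2, hψ.lintegral_enorm_fderiv_rpow hp0, ← ENNReal.ofReal_mul (by positivity),
      ENNReal.ofReal_rpow_of_nonneg hI0 hp0.le, ← ENNReal.ofReal_toReal hC,
      ← ENNReal.ofReal_mul ENNReal.toReal_nonneg, ← ENNReal.ofReal_add (by positivity)
        (by positivity), ENNReal.ofReal_le_ofReal_iff (by positivity)] at h
    simpa using h
  have h2 : mass p ψ ≤ ∫ x in Metric.closedBall 0 R, |ψ x| ^ p ∂gaussMeasure N
      + R⁻¹ * ∫ x, |ψ x| ^ p * ‖x‖ ∂gaussMeasure N := by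
    have i1 := (hψ.integrable_abs_rpow hp0).indicator
      (measurableSet_closedBall (x := (0 : Space N)) (ε := R))
    have i2 : Integrable (fun x => |ψ x| ^ p * ‖x‖) (gaussMeasure N) :=
      (((continuous_abs_rpow hp0).comp hψ.continuous).mul
        continuous_norm).integrable_of_hasCompactSupport
        (hψ.compact.comp_left (g := fun s => |s| ^ p) (by simp [hp0.ne'])).mul_right
    rw [← integral_indicator measurableSet_closedBall, ← integral_const_mul,
      ← integral_add i1 (i2.const_mul _)]
    refine integral_mono (hψ.integrable_abs_rpow hp0) (i1.add (i2.const_mul _)) fun x => ?_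
    have hpos : 0 ≤ |ψ x| ^ p := by positivity
    simp only
    by_cases hx : x ∈ Metric.closedBall (0 : Space N) R
    · rw [Set.indicator_of_mem hx]
      have : 0 ≤ R⁻¹ * (|ψ x| ^ p * ‖x‖) := by positivity
      linarith
    · rw [Set.indicator_of_notMem hx, zero_add]
      rw [mem_closedBall_zero_iff, not_le] at hx
      rw [inv_mul_eq_div, le_div_iff₀ hR0]
      gcongr
  have h3 := hW ψ hψ h0
  have h4 : R⁻¹ * ∫ x, |ψ x| ^ p * ‖x‖ ∂gaussMeasure N ≤ η / 2 * (energy p ψ + mass p ψ) := by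
    calc _ ≤ R⁻¹ * (A * (energy p ψ + mass p ψ)) := by gcongr
      _ = _ := by rw [hR]; field_simp
  have h5 : 0 ≤ (∫ x, ψ x ∂gaussMeasure N) ^ p := by positivity
  nlinarith [mul_nonneg hη.le hM0]

/-- The mass gained to first order by adding a small plateau to `ψ` is governed by `∫ψ^(p-1)`, which
must not degenerate along near-minimizers. The normalization `∫ψ = 1` and the `L^p` bound prevent
this. -/
theorem exists_lower_bound_rpow_sub_one {p C : ℝ} (hp : 1 < p) (hC : 0 < C) : ∃ c₀ > 0,
    ∀ ψ : Space N → ℝ, IsTest ψ → (∀ x, 0 ≤ ψ x) → ∫ x, ψ x ∂gaussMeasure N = 1 →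
      mass p ψ ≤ C → c₀ ≤ ∫ x, ψ x ^ (p - 1) ∂gaussMeasure N := by
  have hp0 : 0 < p := by linarith
  have hp1 : 0 < p - 1 := by linarith
  set K := (4 * C) ^ (p - 1)⁻¹ with hK
  have hK0 : 0 < K := by positivity
  have hKp : K ^ (p - 1) = 4 * C := Real.rpow_inv_rpow (by positivity) hp1.ne'
  set D := max ((1 / 4 : ℝ) ^ (2 - p)) (K ^ (2 - p)) with hD
  have hD0 : 0 < D := lt_max_of_lt_left (by positivity)
  -- The three terms handle `y ≤ 1/4`, `y ≥ K` and the range between, where `y^(2-p) ≤ D` whichever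
  -- sign `2 - p` has. After integration the first two contribute at most `1/4` each, so `D ∫ψ^(p-1)
  -- ≥ 1/2`.
  have hpt : ∀ y : ℝ, 0 ≤ y → y ≤ 1 / 4 + y ^ p / (4 * C) + D * y ^ (p - 1) := by
    intro y hy
    have e1 : 0 ≤ y ^ p / (4 * C) := by positivity
    have e2 : 0 ≤ D * y ^ (p - 1) := by positivity
    rcases le_total y (1 / 4) with h | h
    · linarith
    have hy0 : 0 < y := by linarith
    rcases le_total K y with h' | h'
    · have : y * (4 * C) ≤ y ^ p := by
        rw [← hKp]
        calc y * K ^ (p - 1) ≤ y * y ^ (p - 1) := by gcongr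
          _ = y ^ p := by rw [← Real.rpow_one_add' hy (by linarith)]; congr 1; ring
      have := (le_div_iff₀ (by positivity : (0 : ℝ) < 4 * C)).2 this
      linarith
    · have hle : y ^ (2 - p) ≤ D := by
        rcases le_total 0 (2 - p) with hs | hs
        · exact (Real.rpow_le_rpow hy h' hs).trans (le_max_right _ _)
        · exact (Real.rpow_le_rpow_of_nonpos (by norm_num) h hs).trans (le_max_left _ _)
      have : y ≤ D * y ^ (p - 1) := by
        calc y = y ^ (2 - p) * y ^ (p - 1) := by
              rw [← Real.rpow_add hy0]; norm_num
          _ ≤ _ := by gcongr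
      linarith
  refine ⟨1 / (2 * D), by positivity, fun ψ hψ h0 hI hm => ?_⟩
  have i1 := hψ.integrable_rpow hp0
  have i2 := hψ.integrable_rpow hp1
  have i3 : Integrable (fun x => 1 / 4 + ψ x ^ p / (4 * C)) (gaussMeasure N) :=
    (integrable_const _).add (i1.div_const _)
  have hmass : ∫ x, ψ x ^ p ∂gaussMeasure N = mass p ψ := by
    unfold mass
    congr 1; ext x; rw [abs_of_nonneg (h0 x)]
  have h1 : ∫ x, ψ x ∂gaussMeasure N
      ≤ ∫ x, (1 / 4 + ψ x ^ p / (4 * C) + D * ψ x ^ (p - 1)) ∂gaussMeasure N :=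
    integral_mono hψ.integrable (i3.add (i2.const_mul _))
      fun x => hpt _ (h0 x)
  rw [integral_add i3 (i2.const_mul _),
    integral_add (integrable_const _) (i1.div_const _), integral_const_mul,
    integral_div (4 * C), hmass,
    hI] at h1
  simp only [integral_const, probReal_univ, smul_eq_mul, one_mul] at h1
  have h2 : mass p ψ / (4 * C) ≤ 1 / 4 := by
    rw [div_le_iff₀ (by positivity)]; linarith
  rw [div_le_iff₀ (by positivity)]
  linarith

/-- Bernoulli's inequality for `1 + s/y`, multiplied by `y^p`. -/
theorem rpow_add_ge {p y s : ℝ} (hp : 1 < p) (hy : 0 ≤ y) (hs : 0 ≤ s) :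
    y ^ p + p * s * y ^ (p - 1) ≤ (y + s) ^ p := by
  rcases hy.eq_or_lt with rfl | hy0
  · rw [Real.zero_rpow (by linarith), Real.zero_rpow (by linarith)]
    simp only [zero_add, mul_zero]
    positivity
  · have h := one_add_mul_self_le_rpow_one_add (s := s / y) (by
      have : 0 ≤ s / y := by positivity
      linarith) hp.le
    have h2 := mul_le_mul_of_nonneg_left h (by positivity : 0 ≤ y ^ p)
    rw [← Real.mul_rpow hy (by positivity), show y * (1 + s / y) = y + s by field_simp] at h2
    refine le_trans (le_of_eq ?_) h2
    rw [Real.rpow_sub_one hy0.ne']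
    ring

end Compactness

/-! ### Constants as limits of compactly supported functions. -/

section Cutoff

variable {N : ℕ}

/-- A smooth bump function equal to `1` on the unit ball and supported in the ball of radius `2`. -/
noncomputable def unitBump (N : ℕ) : ContDiffBump (0 : Space N) := ⟨1, 2, one_pos, one_lt_two⟩

/-- A smooth cutoff function equal to `1` on the ball of radius `R`. -/
noncomputable def cutoff (R : ℝ) (x : Space N) : ℝ := unitBump N (R⁻¹ • x)

theorem cutoff_nonneg (R : ℝ) (x : Space N) : 0 ≤ cutoff R x := (unitBump N).nonneg

theorem cutoff_le_one (R : ℝ) (x : Space N) : cutoff R x ≤ 1 := (unitBump N).le_one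

theorem cutoff_eq_one {R : ℝ} (hR : 0 < R) {x : Space N} (hx : ‖x‖ ≤ R) : cutoff R x = 1 := by
  refine (unitBump N).one_of_mem_closedBall ?_
  rw [mem_closedBall_zero_iff, norm_smul, Real.norm_of_nonneg (by positivity)]
  simpa [unitBump, inv_mul_le_iff₀ hR] using hx

theorem isTest_cutoff {R : ℝ} (hR : 0 < R) : IsTest (cutoff R : Space N → ℝ) :=
  ⟨(unitBump N).contDiff.comp (contDiff_const_smul _),
    (unitBump N).hasCompactSupport.comp_homeomorph (Homeomorph.smulOfNeZero R⁻¹ (by positivity))⟩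

theorem exists_norm_fderiv_cutoff_le : ∃ C : ℝ, 0 ≤ C ∧ ∀ R : ℝ, 0 < R → ∀ x : Space N,
    ‖fderiv ℝ (cutoff R : Space N → ℝ) x‖ ≤ C / R := by
  have hd : ContDiff ℝ 1 (unitBump N : Space N → ℝ) := (unitBump N).contDiff
  obtain ⟨C, hC⟩ := (hd.continuous_fderiv (by simp)).bounded_above_of_compact_support
    ((unitBump N).hasCompactSupport.fderiv ℝ)
  refine ⟨C, (norm_nonneg _).trans (hC 0), fun R hR x => ?_⟩
  have h1 : HasFDerivAt (cutoff R : Space N → ℝ) ((fderiv ℝ (unitBump N) (R⁻¹ • x)).comp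
      (R⁻¹ • ContinuousLinearMap.id ℝ (Space N))) x :=
    ((hd.differentiable (by simp)) (R⁻¹ • x)).hasFDerivAt.comp x
      ((hasFDerivAt_id x).const_smul R⁻¹)
  rw [h1.fderiv, ContinuousLinearMap.comp_smul, ContinuousLinearMap.comp_id, norm_smul,
    Real.norm_of_nonneg (by positivity), inv_mul_eq_div]
  exact div_le_div_of_nonneg_right (hC _) hR.le

theorem tendsto_energy_cutoff {p : ℝ} (hp : 0 < p) :
    Tendsto (fun R : ℝ => energy p (cutoff R : Space N → ℝ)) atTop (𝓝 0) := by
  obtain ⟨C, hC0, hC⟩ := exists_norm_fderiv_cutoff_le (N := N)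
  have hlim : Tendsto (fun R : ℝ => (C / R) ^ p) atTop (𝓝 0) := by
    have := (tendsto_const_nhds.div_atTop tendsto_id : Tendsto (fun R : ℝ => C / R) atTop (𝓝 0))
    simpa [hp.ne'] using this.rpow_const (Or.inr hp.le)
  refine tendsto_of_tendsto_of_tendsto_of_le_of_le' tendsto_const_nhds hlim
    (Eventually.of_forall fun R => energy_nonneg _ _) ?_
  filter_upwards [eventually_gt_atTop 0] with R hR
  calc energy p (cutoff R) ≤ ∫ _, (C / R) ^ p ∂gaussMeasure N :=
        integral_mono ((isTest_cutoff hR).integrable_fderiv_rpow hp) (integrable_const _)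
          fun x => Real.rpow_le_rpow (norm_nonneg _) (hC R hR x) hp.le
    _ = _ := by simp

theorem tendsto_mass_cutoff {p : ℝ} (hp : 0 < p) :
    Tendsto (fun R : ℝ => mass p (cutoff R : Space N → ℝ)) atTop (𝓝 1) := by
  have h : Tendsto (fun R : ℝ => mass p (cutoff R : Space N → ℝ)) atTop
      (𝓝 (∫ _, (1 : ℝ) ∂gaussMeasure N)) := by
    refine tendsto_integral_filter_of_dominated_convergence (fun _ => 1) ?_ ?_
      (integrable_const _) ?_
    · filter_upwards [eventually_gt_atTop 0] with R hR
      exact ((isTest_cutoff hR).integrable_abs_rpow hp).aestronglyMeasurable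
    · refine Eventually.of_forall fun R => Eventually.of_forall fun x => ?_
      rw [Real.norm_of_nonneg (by positivity), abs_of_nonneg (cutoff_nonneg R x)]
      exact Real.rpow_le_one (cutoff_nonneg R x) (cutoff_le_one R x) hp.le
    · refine Eventually.of_forall fun x => tendsto_const_nhds.congr' ?_
      filter_upwards [eventually_gt_atTop 0, eventually_ge_atTop ‖x‖] with R hR hx
      rw [cutoff_eq_one hR hx]; simp
  simpa using h

theorem tendsto_integral_cutoff :
    Tendsto (fun R : ℝ => ∫ x, cutoff R x ∂gaussMeasure N) atTop (𝓝 1) := by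
  refine (tendsto_mass_cutoff (N := N) one_pos).congr fun R => ?_
  unfold mass
  congr 1; ext x
  rw [Real.rpow_one, abs_of_nonneg (cutoff_nonneg R x)]

/-- Cutoffs of the constant `c` have energy tending to `0`, and `γ` has total mass `1`, so `F_α`
tends to `α c^p + p c`. -/
theorem exists_testFunctional_gt {p α c r : ℝ} (hp : 1 < p) (hc : 0 ≤ c)
    (hr : r < α * c ^ p + p * c) :
    ∃ ψ : Space N → ℝ, IsTest ψ ∧ r < testFunctional p α ψ := by
  have hp0 : 0 < p := by linarith
  have hlim : Tendsto (fun R : ℝ => -(c ^ p * energy p (cutoff R : Space N → ℝ))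
      + α * (c ^ p * mass p (cutoff R : Space N → ℝ))
      + p * (c * ∫ x, cutoff R x ∂gaussMeasure N)) atTop
      (𝓝 (-(c ^ p * 0) + α * (c ^ p * 1) + p * (c * 1))) :=
    ((((tendsto_energy_cutoff hp0).const_mul _).neg).add
      (((tendsto_mass_cutoff hp0).const_mul _).const_mul _)).add
      ((tendsto_integral_cutoff.const_mul _).const_mul _)
  simp only [mul_zero, neg_zero, zero_add, mul_one] at hlim
  obtain ⟨R, hR, hR0⟩ := ((hlim.eventually_const_lt hr).and (eventually_gt_atTop 0)).exists
  refine ⟨fun x => c * cutoff R x, (isTest_cutoff hR0).const_mul c, ?_⟩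
  rw [testFunctional, (isTest_cutoff hR0).energy_const_mul hc, mass_const_mul _ hc,
    integral_const_mul]
  exact hR

end Cutoff

/-! ### Behaviour as `t → +∞`, and plateau functions. -/

section HalfSpace

variable {N : ℕ} [NeZero N]

theorem eventually_lt_torsionSharp {p α c r : ℝ} (hp : 1 < p) (hc : 0 ≤ c)
    (hr : r < α * c ^ p + p * c) : ∀ᶠ t in atTop, (r : EReal) < torsionSharp N p α t := by
  obtain ⟨ψ, hψ, hlt⟩ := exists_testFunctional_gt (N := N) hp hc hr
  obtain ⟨t₀, ht₀⟩ := hψ.exists_halfSpace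
  filter_upwards [eventually_ge_atTop t₀] with t ht
  exact (EReal.coe_lt_coe_iff.2 hlt).trans_le (testFunctional_le_torsion hp α (ht₀.mono ht))

/-- Cutoffs of `1` have Rayleigh quotient tending to `0`, and each lies in some half-space. -/
theorem exists_not_halfPoincare {p c : ℝ} (hp : 1 < p) (hc : 0 < c) :
    ∃ t, ¬ HalfPoincare N p t c := by
  by_contra! h
  have hp0 : 0 < p := by linarith
  have : c * 1 ≤ 0 := by
    refine le_of_tendsto_of_tendsto ((tendsto_mass_cutoff (N := N) hp0).const_mul c)
      (tendsto_energy_cutoff (N := N) hp0) ?_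
    filter_upwards [eventually_gt_atTop 0] with R hR
    obtain ⟨t, ht⟩ := (isTest_cutoff (N := N) hR).exists_halfSpace
    exact h t _ ht
  linarith

/-- Compact subsets of `H_a` admit plateau functions supported in `H_b`, `a < b`, with uniformly
bounded energy. -/
theorem exists_plateau {p a b : ℝ} (hp : 0 < p) (hab : a < b) : ∃ A : ℝ, 0 ≤ A ∧
    ∀ R : ℝ, ∃ η : Space N → ℝ, IsTestIn (halfSpace N b) η ∧ (∀ x, 0 ≤ η x) ∧
      (∀ x, x 0 < a → ‖x‖ < R → η x = 1) ∧ energy p η ≤ A := by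
  obtain ⟨C, hC0, hC⟩ := exists_norm_fderiv_cutoff_le (N := N)
  -- The profile vanishes already beyond the midpoint, so the closed support stays inside the open
  -- half-space `H_b`.
  set b' := (a + b) / 2 with hb'
  have hab' : 0 < b' - a := by rw [hb']; linarith
  have hθd : ContDiff ℝ ((⊤ : ℕ∞) : WithTop ℕ∞) Real.smoothTransition :=
    Real.smoothTransition.contDiff
  have hθc : Continuous (deriv Real.smoothTransition) := hθd.continuous_deriv (by simp)
  have hθs : HasCompactSupport (deriv Real.smoothTransition) := by
    refine HasCompactSupport.of_support_subset_isCompact (isCompact_Icc (a := (0 : ℝ)) (b := 1))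
      fun s hs => ?_
    by_contra hn
    refine hs ?_
    rw [Set.mem_Icc, not_and_or, not_le, not_le] at hn
    rcases hn with hn | hn
    · have : Real.smoothTransition =ᶠ[𝓝 s] fun _ => 0 := by
        filter_upwards [Iio_mem_nhds hn] with r hr
        exact Real.smoothTransition.zero_of_nonpos (le_of_lt hr)
      simpa using this.deriv_eq
    · have : Real.smoothTransition =ᶠ[𝓝 s] fun _ => 1 := by
        filter_upwards [Ioi_mem_nhds hn] with r hr
        exact Real.smoothTransition.one_of_one_le (le_of_lt hr)
      simpa using this.deriv_eq
  obtain ⟨L, hL⟩ := hθc.bounded_above_of_compact_support hθs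
  have hL0 : 0 ≤ L := (norm_nonneg _).trans (hL 0)
  set k := (b' - a)⁻¹ with hk
  have hk0 : 0 < k := by positivity
  refine ⟨(C + L * k) ^ p, by positivity, fun R₀ => ?_⟩
  -- Radii at least `1` bound the cutoff gradient by `C`, making the energy bound independent of the
  -- ball.
  set R := max R₀ 1 with hR
  have hR1 : 1 ≤ R := le_max_right _ _
  have hR0 : 0 < R := by linarith
  set f : Space N → ℝ := fun x => Real.smoothTransition ((b' - x 0) * k) with hf
  have hfd : ContDiff ℝ ((⊤ : ℕ∞) : WithTop ℕ∞) f :=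
    hθd.comp ((contDiff_const.sub (contDiff_coord 0)).mul contDiff_const)
  have hχ := isTest_cutoff (N := N) hR0
  have ht : IsTestIn (halfSpace N b) (fun x => f x * cutoff R x) := by
    refine ⟨⟨hfd.mul hχ.contDiff, hχ.compact.mul_left⟩, ?_⟩
    have hcl : IsClosed {x : Space N | x 0 ≤ b'} := isClosed_le (by fun_prop) continuous_const
    have hsub : tsupport (fun x => f x * cutoff R x) ⊆ {x : Space N | x 0 ≤ b'} := by
      refine closure_minimal (fun x hx => ?_) hcl
      by_contra hn
      rw [Set.mem_ofPred_eq, not_le] at hn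
      refine hx ?_
      have : f x = 0 := Real.smoothTransition.zero_of_nonpos
        (mul_nonpos_of_nonpos_of_nonneg (by linarith) hk0.le)
      simp only [this, zero_mul]
    intro x hx
    have : x 0 ≤ b' := hsub hx
    exact mem_halfSpace.2 (by rw [hb'] at this; linarith)
  refine ⟨_, ht, fun x => mul_nonneg (Real.smoothTransition.nonneg _) (cutoff_nonneg _ _),
    fun x hx hxR => ?_, ?_⟩
  · rw [cutoff_eq_one hR0 (hxR.le.trans (le_max_left _ _)), mul_one]
    refine Real.smoothTransition.one_of_one_le ?_
    rw [hk, ← div_eq_mul_inv, one_le_div hab']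
    linarith
  · have hbound : ∀ x, ‖fderiv ℝ (fun x => f x * cutoff R x) x‖ ≤ C + L * k := by
      intro x
      have h1 : HasFDerivAt f (deriv Real.smoothTransition ((b' - x 0) * k) •
          (k • -coord 0)) x :=
        ((hθd.differentiable (by simp)) _).hasDerivAt.comp_hasFDerivAt x
          (((hasFDerivAt_coord 0 x).const_sub b').mul_const k)
      have h2 := h1.mul (hχ.differentiable x).hasFDerivAt
      have h3 : fderiv ℝ (fun x => f x * cutoff R x) x = _ := h2.fderiv
      rw [h3]
      refine (norm_add_le _ _).trans ?_
      rw [norm_smul, norm_smul, norm_smul, norm_smul, norm_neg,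
        Real.norm_of_nonneg (cutoff_nonneg R x), Real.norm_of_nonneg hk0.le,
        Real.norm_of_nonneg (Real.smoothTransition.nonneg _ : 0 ≤ f x)]
      have e1 : f x ≤ 1 := Real.smoothTransition.le_one _
      have e2 := cutoff_le_one R x
      have e3 := norm_coord_le (N := N) 0
      have e4 := hL ((b' - x 0) * k)
      have e5 : ‖fderiv ℝ (cutoff R : Space N → ℝ) x‖ ≤ C :=
        (hC R hR0 x).trans (div_le_self hC0 hR1)
      have e6 : 0 ≤ f x := Real.smoothTransition.nonneg _
      calc _ ≤ 1 * C + 1 * (L * (k * 1)) := by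
            gcongr
        _ = _ := by ring
    calc _ ≤ ∫ _, (C + L * k) ^ p ∂gaussMeasure N :=
          integral_mono (ht.integrable_fderiv_rpow hp) (integrable_const _)
            fun x => Real.rpow_le_rpow (norm_nonneg _) (hbound x) hp.le
      _ = _ := by simp

end HalfSpace

/-! ### Unboundedness at the critical half-space and strict monotonicity of the constant. -/

section Critical

variable {N : ℕ} [NeZero N]

/-- Near-minimizers of the Rayleigh quotient, normalized in `L^1`, are bounded in `L^p`. -/
theorem exists_normalized {p α : ℝ} (hp : 1 < p) (hα : 0 ≤ α) : ∃ C > 0, ∀ t c : ℝ, α < c →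
    c ≤ α + 1 → ¬ HalfPoincare N p t c → ∃ ψ : Space N → ℝ, IsTestIn (halfSpace N t) ψ ∧
      (∀ x, 0 ≤ ψ x) ∧ ∫ x, ψ x ∂gaussMeasure N = 1 ∧ mass p ψ ≤ C ∧
      energy p ψ - α * mass p ψ ≤ (c - α) * C := by
  have hp0 : 0 < p := by linarith
  -- A violation of the inequality with `c ≤ α + 1` gives `E + M ≤ (α + 2) M`, so this `η` lets half
  -- of `M` be absorbed on the left.
  obtain ⟨C, hC, hb⟩ := exists_compactness_bound (N := N) hp (η := 1 / (2 * (α + 2)))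
    (by positivity)
  refine ⟨2 * C, by positivity, fun t c hαc hc hn => ?_⟩
  obtain ⟨ψ, hψ, h0, hlt⟩ : ∃ ψ : Space N → ℝ, IsTestIn (halfSpace N t) ψ ∧ (∀ x, 0 ≤ ψ x) ∧
      energy p ψ < c * mass p ψ := by
    by_contra! h
    exact hn fun φ hφ => poincare_of_nonneg hp h hφ
  have hE := energy_nonneg p ψ
  have hc0 : 0 < c := by linarith
  have hM : 0 < mass p ψ := by
    by_contra hM
    have : c * mass p ψ ≤ 0 := mul_nonpos_of_nonneg_of_nonpos hc0.le (not_lt.1 hM)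
    linarith
  set I := ∫ x, ψ x ∂gaussMeasure N with hI
  have hI0 : 0 ≤ I := integral_nonneg h0
  have h1 : mass p ψ ≤ 2 * C * I ^ p := by
    have h2 := hb ψ hψ.toIsTest h0
    have h3 : energy p ψ + mass p ψ ≤ (α + 2) * mass p ψ := by nlinarith
    have h4 : 1 / (2 * (α + 2)) * (energy p ψ + mass p ψ) ≤ mass p ψ / 2 := by
      calc _ ≤ 1 / (2 * (α + 2)) * ((α + 2) * mass p ψ) := by gcongr
        _ = _ := by field_simp
    linarith
  have hIpos : 0 < I := by
    refine lt_of_le_of_ne hI0 fun h => ?_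
    rw [← h, Real.zero_rpow hp0.ne', mul_zero] at h1
    linarith
  have hm : mass p (fun x => I⁻¹ * ψ x) ≤ 2 * C := by
    rw [mass_const_mul _ (by positivity), Real.inv_rpow hI0, inv_mul_le_iff₀ (by positivity)]
    linarith
  refine ⟨fun x => I⁻¹ * ψ x, ⟨hψ.toIsTest.const_mul _, ?_⟩, fun x => mul_nonneg (by positivity)
    (h0 x), ?_, hm, ?_⟩
  · exact (closure_mono (Function.support_const_smul_subset I⁻¹ ψ)).trans hψ.subset
  · rw [integral_const_mul, ← hI, inv_mul_cancel₀ hIpos.ne']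
  · have hle : energy p (fun x => I⁻¹ * ψ x) ≤ c * mass p (fun x => I⁻¹ * ψ x) := by
      rw [hψ.energy_const_mul (by positivity), mass_const_mul _ (by positivity)]
      have := mul_le_mul_of_nonneg_left hlt.le (by positivity : 0 ≤ I⁻¹ ^ p)
      linarith
    have : (c - α) * mass p (fun x => I⁻¹ * ψ x) ≤ (c - α) * (2 * C) :=
      mul_le_mul_of_nonneg_left hm (by linarith)
    linarith

/-- At the critical half-space the functional is unbounded on test functions. -/
theorem exists_testFunctional_gt_of_critical {p α t : ℝ} (hp : 1 < p) (hα : 0 ≤ α)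
    (h : ∀ c > α, ¬ HalfPoincare N p t c) {M : ℝ} (hM : 0 < M) :
    ∃ ψ : Space N → ℝ, IsTestIn (halfSpace N t) ψ ∧ M ≤ testFunctional p α ψ := by
  have hp0 : 0 < p := by linarith
  obtain ⟨C, hC, hex⟩ := exists_normalized (N := N) hp hα
  -- For `∫ψ = 1`, `F_α(Mψ) = pM - M^p (E - α m) ≥ pM - M^p ε C`; this `ε` makes the loss at most
  -- `(p - 1) M`. The bound `1` keeps `α + ε` in the range of `exists_normalized`.
  set ε := min 1 ((p - 1) * M / (M ^ p * C)) with hε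
  have hp1 : 0 < p - 1 := by linarith
  have hMp : 0 < M ^ p := by positivity
  have hε0 : 0 < ε := lt_min one_pos (by positivity)
  obtain ⟨ψ, hψ, h0, hI, -, hE⟩ := hex t (α + ε) (by linarith)
    (by linarith [min_le_left 1 ((p - 1) * M / (M ^ p * C))]) (h _ (by linarith))
  refine ⟨fun x => M * ψ x, ⟨hψ.toIsTest.const_mul _, ?_⟩, ?_⟩
  · exact (closure_mono (Function.support_const_smul_subset M ψ)).trans hψ.subset
  · rw [testFunctional, hψ.energy_const_mul hM.le, mass_const_mul _ hM.le, integral_const_mul, hI]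
    have h1 : M ^ p * (ε * C) ≤ (p - 1) * M := by
      have : ε * (M ^ p * C) ≤ (p - 1) * M := by
        rw [← le_div_iff₀ (by positivity)]; exact min_le_right _ _
      linarith
    rw [add_sub_cancel_left] at hE
    have h2 := mul_le_mul_of_nonneg_left hE hMp.le
    linarith

/-- The Poincaré constant improves strictly on smaller half-spaces. -/
theorem HalfPoincare.exists_const_gt {p α t t' : ℝ} (hp : 1 < p) (hα : 0 < α) (ht : t < t')
    (h : HalfPoincare N p t' α) : ∃ c > α, HalfPoincare N p t c := by
  by_contra! hcon
  have hp0 : 0 < p := by linarith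
  have hp1 : 0 < p - 1 := by linarith
  obtain ⟨C, hC, hex⟩ := exists_normalized (N := N) hp hα.le
  obtain ⟨c₀, hc₀, hJ⟩ := exists_lower_bound_rpow_sub_one (N := N) hp hC
  obtain ⟨A, hA, hplat⟩ := exists_plateau (N := N) hp0 ht
  -- Test the inequality on `H_t'` with `ψ + s η`, where `ψ` is a near-minimizer on `H_t` and `η` a
  -- plateau around its support: the gain in mass is linear in `s`, the cost in energy only of order
  -- `s^p`.
  have key : ∀ s > 0, ∀ c, α < c → c ≤ α + 1 → α * (p * s * c₀) ≤ (c - α) * C + s ^ p * A := by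
    intro s hs c hαc hc
    obtain ⟨ψ, hψ, h0, hI, hm, hE⟩ := hex t c hαc hc (hcon c hαc)
    obtain ⟨R, hR⟩ := hψ.compact.isCompact.isBounded.subset_ball (0 : Space N)
    obtain ⟨η, hη, hη0, hη1, hηE⟩ := hplat R
    have hone : ∀ x ∈ tsupport ψ, η =ᶠ[𝓝 x] fun _ => 1 := by
      intro x hx
      have h1 : ∀ᶠ y in 𝓝 x, y ∈ halfSpace N t := (halfSpace N t).isOpen.mem_nhds (hψ.subset hx)
      have h2 : ∀ᶠ y in 𝓝 x, y ∈ Metric.ball (0 : Space N) R :=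
        Metric.isOpen_ball.mem_nhds (hR hx)
      filter_upwards [h1, h2] with y hy1 hy2
      exact hη1 y hy1 (by simpa using hy2)
    have hu : IsTestIn (halfSpace N t') (fun x => ψ x + s * η x) := by
      have hsη : IsTest (fun x => s * η x) := hη.toIsTest.const_mul s
      refine ⟨⟨hψ.contDiff.add hsη.contDiff, hψ.compact.add hsη.compact⟩, ?_⟩
      refine (tsupport_add ψ (fun x => s * η x)).trans (Set.union_subset
        (hψ.mono ht.le).subset ?_)
      exact (closure_mono (Function.support_const_smul_subset s η)).trans hη.subset
    -- Energies add exactly, since `η` is locally constant near the support of `ψ`.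
    have hEu : energy p (fun x => ψ x + s * η x) = energy p ψ + s ^ p * energy p η := by
      unfold energy
      rw [← integral_const_mul, ← integral_add (hψ.integrable_fderiv_rpow hp0)
        ((hη.integrable_fderiv_rpow hp0).const_mul _)]
      congr 1; ext x
      have hd : fderiv ℝ (fun x => ψ x + s * η x) x = fderiv ℝ ψ x + s • fderiv ℝ η x := by
        rw [fderiv_fun_add (hψ.differentiable x) ((hη.differentiable x).const_mul s),
          hη.fderiv_const_mul]
      rw [hd]
      by_cases hx : x ∈ tsupport ψ
      · have : fderiv ℝ η x = 0 := by
          rw [(hone x hx).fderiv_eq]; simp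
        rw [this]
        simp [hp0.ne']
      · have : fderiv ℝ ψ x = 0 :=
          image_eq_zero_of_notMem_tsupport fun h' => hx (tsupport_fderiv_subset ℝ h')
        rw [this, zero_add, norm_smul, Real.norm_of_nonneg hs.le,
          Real.mul_rpow hs.le (norm_nonneg _)]
        simp [hp0.ne']
    have hMu : mass p ψ + p * s * ∫ x, ψ x ^ (p - 1) ∂gaussMeasure N
        ≤ mass p (fun x => ψ x + s * η x) := by
      unfold mass
      rw [← integral_const_mul, ← integral_add (hψ.integrable_abs_rpow hp0)
        ((hψ.integrable_rpow hp1).const_mul _)]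
      refine integral_mono ((hψ.integrable_abs_rpow hp0).add
        ((hψ.integrable_rpow hp1).const_mul _)) (hu.integrable_abs_rpow hp0) fun x => ?_
      simp only
      by_cases hx : x ∈ tsupport ψ
      · rw [(hone x hx).eq_of_nhds, mul_one, abs_of_nonneg (h0 x),
          abs_of_nonneg (add_nonneg (h0 x) hs.le)]
        exact rpow_add_ge hp (h0 x) hs.le
      · rw [image_eq_zero_of_notMem_tsupport hx, abs_zero, Real.zero_rpow hp0.ne',
          Real.zero_rpow hp1.ne', mul_zero, add_zero]
        positivity
    have h1 := h _ hu
    rw [hEu] at h1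
    have h2 := mul_le_mul_of_nonneg_left hMu hα.le
    have h3 : s ^ p * energy p η ≤ s ^ p * A := by gcongr
    have h4 : α * (p * s * c₀) ≤ α * (p * s * ∫ x, ψ x ^ (p - 1) ∂gaussMeasure N) := by
      gcongr
      exact hJ ψ hψ.toIsTest h0 hI hm
    linarith
  -- Let `c → α` with `s` fixed, then divide by `s`; since `p > 1`, letting `s → 0` afterwards
  -- forces `α p c₀ ≤ 0`.
  have key2 : ∀ s > 0, α * (p * c₀) ≤ s ^ (p - 1) * A := by
    intro s hs
    have hlim : Tendsto (fun c => (c - α) * C + s ^ p * A) (𝓝[>] α) (𝓝 (s ^ p * A)) := by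
      have hc : Continuous fun c => (c - α) * C + s ^ p * A := by fun_prop
      simpa using (hc.tendsto α).mono_left (nhdsWithin_le_nhds (s := Set.Ioi α))
    have h1 : α * (p * s * c₀) ≤ s ^ p * A := by
      refine ge_of_tendsto hlim ?_
      filter_upwards [Ioc_mem_nhdsGT (lt_add_one α)] with c hc
      exact key s hs c hc.1 hc.2
    rw [Real.rpow_sub_one hs.ne', div_mul_eq_mul_div, le_div_iff₀ hs]
    linarith
  have hlim : Tendsto (fun s : ℝ => s ^ (p - 1) * A) (𝓝[>] 0) (𝓝 0) := by
    have hc : Continuous fun s : ℝ => s ^ (p - 1) * A :=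
      (continuous_id.rpow_const fun _ => Or.inr hp1.le).mul continuous_const
    have := (hc.tendsto 0).mono_left (nhdsWithin_le_nhds (s := Set.Ioi 0))
    simpa [hp1.ne'] using this
  have : α * (p * c₀) ≤ 0 := ge_of_tendsto hlim (by
    filter_upwards [self_mem_nhdsWithin] with s hs
    exact key2 s hs)
  have : 0 < α * (p * c₀) := by positivity
  linarith

end Critical

/-! ### The critical half-space and the three regimes of `α`. -/

section Main

variable {N : ℕ} [NeZero N]

theorem le_firstEigenvalue_halfSpace_iff {p t c : ℝ} (hp : 1 < p) (hc : 0 ≤ c) :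
    (c : EReal) ≤ firstEigenvalue p (halfSpace N t) ↔ HalfPoincare N p t c :=
  ⟨fun h _ hψ => mul_mass_le_energy_of_le_firstEigenvalue hp h hψ, le_firstEigenvalue hp hc⟩

theorem firstEigenvalue_halfSpace_eq_iff {p t α : ℝ} (hp : 1 < p) (hα : 0 ≤ α) :
    firstEigenvalue p (halfSpace N t) = (α : EReal) ↔
      HalfPoincare N p t α ∧ ∀ c > α, ¬ HalfPoincare N p t c := by
  rw [← le_firstEigenvalue_halfSpace_iff hp hα]
  constructor
  · intro h
    refine ⟨h.ge, fun c hc hP => ?_⟩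
    rw [← le_firstEigenvalue_halfSpace_iff hp (by linarith), h, EReal.coe_le_coe_iff] at hP
    linarith
  · rintro ⟨h1, h2⟩
    refine le_antisymm (le_of_not_gt fun h => ?_) h1
    obtain ⟨c, hc1, hc2⟩ := EReal.lt_iff_exists_real_btwn.1 h
    have hc : α < c := EReal.coe_lt_coe_iff.1 hc1
    exact h2 c hc ((le_firstEigenvalue_halfSpace_iff hp (by linarith)).1 hc2.le)

theorem exists_firstEigenvalue_eq {p α : ℝ} (hp : 1 < p) (hα : 0 < α) :
    ∃ t, firstEigenvalue p (halfSpace N t) = (α : EReal) := by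
  set S := {t | HalfPoincare N p t α} with hS
  have hne : S.Nonempty :=
    ⟨-α - (p - 1), (halfPoincare_neg hp _).anti_const (by linarith)⟩
  obtain ⟨t₀, ht₀⟩ := exists_not_halfPoincare (N := N) hp hα
  have hbdd : BddAbove S := ⟨t₀, fun t ht => le_of_not_gt fun h => ht₀ (ht.anti h.le)⟩
  -- At the supremum `α` itself is admissible by exhaustion from inside, while an admissible `c > α`
  -- would make `α` admissible beyond the supremum.
  refine ⟨sSup S, (firstEigenvalue_halfSpace_eq_iff hp hα.le).2 ⟨?_, fun c hc hP => ?_⟩⟩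
  · refine halfPoincare_of_forall_lt fun t ht => ?_
    obtain ⟨t', ht', hlt⟩ := exists_lt_of_lt_csSup hne ht
    exact HalfPoincare.anti hlt.le ht'
  · obtain ⟨t', ht', h⟩ := hP.exists_gt hp hc
    exact (le_csSup hbdd h).not_gt ht'

theorem torsionSharp_isFinite {p α c t : ℝ} (hp : 1 < p) (hc : 0 ≤ c) (hα : α < c)
    (h : HalfPoincare N p t c) : IsFinite (torsionSharp N p α t) :=
  torsion_isFinite hp hc hα h

theorem halfPoincare_zero (p t : ℝ) : HalfPoincare N p t 0 := fun ψ _ => by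
  rw [zero_mul]; exact energy_nonneg _ _

theorem tendsto_torsionSharp_of_neg {p α : ℝ} (hp : 1 < p) (hα : α < 0) :
    Tendsto (fun t : ℝ => torsionSharp N p α t) atTop
      (𝓝 (((p - 1) * (-1 / α) ^ (1 / (p - 1)) : ℝ) : EReal)) := by
  have hp1 : 0 < p - 1 := by linarith
  have hα' : 0 < -1 / α := div_pos_of_neg_of_neg (by norm_num) hα
  -- The maximizer of `α c^p + p c` over `c ≥ 0`; its value is the Young bound of `torsion_le` for
  -- Poincaré constant `0`.
  set c := (-1 / α) ^ (1 / (p - 1)) with hc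
  have hc0 : 0 < c := by positivity
  have hval : α * c ^ p + p * c = (p - 1) * c := by
    have h1 : c ^ p = c * (-1 / α) := by
      rw [← Real.rpow_inv_rpow hα'.le hp1.ne', ← one_div, ← hc,
        ← Real.rpow_one_add' hc0.le (by linarith)]
      congr 1; ring
    have hα0 : α ≠ 0 := hα.ne
    rw [h1]
    field_simp
    ring
  refine tendsto_order.2 ⟨fun a ha => ?_, fun a ha => Eventually.of_forall fun t => ?_⟩
  · obtain ⟨r, hr1, hr2⟩ := EReal.lt_iff_exists_real_btwn.1 ha
    have hr : r < α * c ^ p + p * c := by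
      rw [hval]; exact EReal.coe_lt_coe_iff.1 hr2
    filter_upwards [eventually_lt_torsionSharp (N := N) hp hc0.le hr] with t ht
    exact hr1.trans ht
  · refine lt_of_le_of_lt ?_ ha
    have := torsion_le hp le_rfl hα (halfPoincare_zero (N := N) p t)
    rwa [zero_sub, one_div_neg_eq_neg_one_div, ← neg_div] at this

theorem tendsto_torsionSharp_zero {p : ℝ} (hp : 1 < p) :
    Tendsto (fun t : ℝ => torsionSharp N p 0 t) atTop (𝓝 (⊤ : EReal)) := by
  refine EReal.tendsto_nhds_top_iff_real.2 fun r => ?_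
  refine eventually_lt_torsionSharp hp (c := |r| + 1) (by positivity) ?_
  have := le_abs_self r
  have := abs_nonneg r
  nlinarith

theorem exists_lt_testFunctional {p α t : ℝ} (hp : 1 < p) (hα : 0 ≤ α)
    (h : ∀ c > α, ¬ HalfPoincare N p t c) (r : ℝ) :
    ∃ ψ : Space N → ℝ, IsTestIn (halfSpace N t) ψ ∧ r < testFunctional p α ψ := by
  obtain ⟨ψ, hψ, hle⟩ := exists_testFunctional_gt_of_critical hp hα h
    (by positivity : 0 < |r| + 1)
  exact ⟨ψ, hψ, by linarith [le_abs_self r]⟩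

theorem torsionSharp_isFinite_iff {p α tbar : ℝ} (hp : 1 < p) (hα : 0 < α)
    (h : firstEigenvalue p (halfSpace N tbar) = (α : EReal)) (t : ℝ) :
    IsFinite (torsionSharp N p α t) ↔ t < tbar := by
  obtain ⟨h1, h2⟩ := (firstEigenvalue_halfSpace_eq_iff hp hα.le).1 h
  constructor
  · rintro ⟨r, hr⟩
    by_contra! ht
    obtain ⟨ψ, hψ, hlt⟩ := exists_lt_testFunctional hp hα.le h2 r
    have hle : ((testFunctional p α ψ : ℝ) : EReal) ≤ torsionSharp N p α t :=
      testFunctional_le_torsion hp α (hψ.mono ht)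
    rw [hr, EReal.coe_le_coe_iff] at hle
    linarith
  · intro ht
    obtain ⟨c, hc, hP⟩ := h1.exists_const_gt hp hα ht
    exact torsionSharp_isFinite hp (by linarith) hc hP

theorem tendsto_torsionSharp_of_pos {p α tbar : ℝ} (hp : 1 < p) (hα : 0 < α)
    (h : firstEigenvalue p (halfSpace N tbar) = (α : EReal)) :
    Tendsto (fun t : ℝ => torsionSharp N p α t) (𝓝[<] tbar) (𝓝 (⊤ : EReal)) := by
  obtain ⟨-, h2⟩ := (firstEigenvalue_halfSpace_eq_iff hp hα.le).1 h
  refine EReal.tendsto_nhds_top_iff_real.2 fun r => ?_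
  obtain ⟨ψ, hψ, hlt⟩ := exists_lt_testFunctional hp hα.le h2 r
  -- A test function with large `F_α` at the critical half-space already lives in a smaller one, so
  -- the blow-up is felt as `t` approaches from the left.
  obtain ⟨t', ht', hψ'⟩ := hψ.exists_lt
  filter_upwards [Ioo_mem_nhdsLT ht'] with t ht
  exact (EReal.coe_lt_coe_iff.2 hlt).trans_le (testFunctional_le_torsion hp α (hψ'.mono ht.1.le))

end Main

end GaussTorsion

theorem mainTheorem10 (N : ℕ) [NeZero N] (p : ℝ) (hp : 1 < p) :
    (∀ α : ℝ, α < 0 →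
      (∀ t : ℝ, GaussTorsion.IsFinite (GaussTorsion.torsionSharp N p α t)) ∧
      Tendsto (fun t : ℝ => GaussTorsion.torsionSharp N p α t) atTop
        (𝓝 (((p - 1) * (-1 / α) ^ (1 / (p - 1)) : ℝ) : EReal))) ∧
    ((∀ t : ℝ, GaussTorsion.IsFinite (GaussTorsion.torsionSharp N p 0 t)) ∧
      Tendsto (fun t : ℝ => GaussTorsion.torsionSharp N p 0 t) atTop (𝓝 (⊤ : EReal))) ∧
    (∀ α : ℝ, 0 < α →
      (∃ tbar : ℝ,
        GaussTorsion.firstEigenvalue p (GaussTorsion.halfSpace N tbar) = (α : EReal)) ∧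
      ∀ tbar : ℝ,
        GaussTorsion.firstEigenvalue p (GaussTorsion.halfSpace N tbar) = (α : EReal) →
        (∀ t : ℝ, GaussTorsion.IsFinite (GaussTorsion.torsionSharp N p α t) ↔ t < tbar) ∧
        Tendsto (fun t : ℝ => GaussTorsion.torsionSharp N p α t) (𝓝[<] tbar)
          (𝓝 (⊤ : EReal))) := by
  refine ⟨fun α hα => ⟨fun t => ?_, GaussTorsion.tendsto_torsionSharp_of_neg hp hα⟩,
    ⟨fun t => ?_, GaussTorsion.tendsto_torsionSharp_zero hp⟩,
    fun α hα => ⟨GaussTorsion.exists_firstEigenvalue_eq hp hα, fun tbar h =>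
      ⟨GaussTorsion.torsionSharp_isFinite_iff hp hα h,
        GaussTorsion.tendsto_torsionSharp_of_pos hp hα h⟩⟩⟩
  · exact GaussTorsion.torsionSharp_isFinite hp le_rfl hα (GaussTorsion.halfPoincare_zero p t)
  · obtain ⟨c, hc, hP⟩ := GaussTorsion.exists_halfPoincare_pos (N := N) hp t
    exact GaussTorsion.torsionSharp_isFinite hp hc.le hc hP
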